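/- Let $u/v>1$ be a reduced fraction with $u$ odd, and let $K_{u/v}$ be the rational knot which is the numerator closure of the rational tangle $\tau_{u/v}$. **The picture.** Let $M=\mathbb C\setminus\{X^+,X^-,Y\}$, where the punctures lie on the real axis in the order $X^-,Y,X^+$ if $v$ is odd and $X^-,X^+,Y$ if $v$ is even; let $\beta$ be the horizontal segment between $Y$ and $X^+$. Let $\alpha_{u/v}$ be the arc of slope $u/v$ from $X^-$ to $X^+$ and let $\overline{\alpha_{u/v}}$ be the closed curve bounding a thin band around it. Up to isotopy the picture is the following one: $X^-=0$, $\{Y,X^+\}=\{2v,2(u+v)\}$, and $\overline{\alpha_{u/v}}$ crosses the real axis vertically at the odd integers in $(-2u,2u+4v)$, a crossing at $x$ being joined in the upper half plane by a semicircle to the crossing at $4v-x$, and in the lower half plane by a semicircle to the crossing at $-x$ if $|x|<2u$ and at $4(u+v)-x$ if $x>2u$. The curve $\overline{\alpha_{u/v}}$ meets $\beta$ in $u$ points $\kappa_1,\dots,\kappa_u$; let $\kappa_\omega$ be the right-most one if $v$ is odd and the left-most one if $v$ is even (the one next to $X^+$). Paths along $\overline{\alpha_{u/v}}$ are always required to avoid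 the part of this curve that wraps around $X^-$, so that there is exactly one such path, up to reparametrization, between two given points $\kappa_j$ and $\kappa_i$. **The loops.** Let $\gamma_{j,i}$ be the loop in $M$ which goes from $\kappa_j$ to $\kappa_i$ along $\overline{\alpha_{u/v}}$ and back along $\beta$, and let $\gamma_i=\gamma_{i,\omega}$. Take two parallel copies of $\beta$, a top one $\beta_1$ and a bottom one $\beta_2$. In the space $\mathrm{Conf}^2(M)$ of unordered pairs of distinct points of $M$, the base point for the pair $\kappa_j,\kappa_i$ has the point further to the left on $\beta_1$ and the other one on $\beta_2$ (for $i=j$ there is one point on each). Sliding $\kappa_j$ along $\overline{\alpha_{u/v}}$ to $\kappa_i$ gives a path from the base point to the configuration with $\kappa_i$ on both copies of $\beta$; if on its arrival $\kappa_j$ would run into the other point, it stops there and the other point moves on, in the same direction along $\overline{\alpha_{u/v}}$, to the other copy of $\beta$. * $\tilde\gamma_{j,i}$ is the loop in $\mathrm{Conf}^2(M)$ which is this path followed by returning to the base point along the copies of $\beta$. * $\gamma^{2,K}_{j,i}$ is the loop in $\mathrm{Conf}^2(M)$ which is this path, followed by sliding the two points $\kappa_i$ together along $\overline{\alpha_{u/v}}$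 until both are at $\kappa_\omega$, followed by returning to the base point along $\beta_1$ and $\beta_2$. **The homomorphisms.** Identify $\pi_1(\mathrm{Conf}^n(\mathbb C))$ with the braid group $\mathrm{Br}_n$, a clockwise half twist of two points being a positive crossing, and let $\mathrm{ab}:\mathrm{Br}_n\to\mathbb Z$ be the number of positive minus the number of negative crossings. For a puncture $V$ let $\Psi^1_V:\pi_1(M)\to\pi_1(\mathrm{Conf}^2(\mathbb C))\to\mathbb Z$ and $\Psi^2_V:\pi_1(\mathrm{Conf}^2(M))\to\pi_1(\mathrm{Conf}^3(\mathbb C))\to\mathbb Z$ be given by adding the constant point $V$ and applying $\mathrm{ab}$; for a set $W$ of punctures let $\Psi_W=\frac12\sum_{V\in W}\Psi^1_V$; and let $\Phi=\Phi^2:\pi_1(\mathrm{Conf}^2(M))\to\pi_1(\mathrm{Conf}^2(\mathbb C))\to\mathbb Z$ be induced by the inclusion, followed by $\mathrm{ab}$. **The matrix.** Build $\tau_{(u-v)/v}$ from $\tau_{0/1}$, which has orientation $UP$, by top twists $T:\tau_{p/q}\mapsto\tau_{(p+q)/q}$ and right twists $R:\tau_{p/q}\mapsto\tau_{p/(p+q)}$,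 the first twist being $T$. Here $T$ maps the orientations $UP,OP,RI$ to $UP,RI,OP$ and $R$ maps them to $OP,UP,RI$. Write $OP^+$ (resp. $OP^-$) for $OP$ if $p>q$ (resp. $p<q$), and let $\mu_3(K_{u/v})=\#\{RUP,ROP^-\}-\#\{TOP^+,TRI,RRI\}$, where $TX$ or $RX$ stands for the twists in this construction that are applied to a tangle of orientation $X$. Let $Q$ be the $u\times u$ integer matrix with $$Q_{ii}=(\Psi_{\{X^-,Y\}}-3\Psi_{X^+})([\gamma_i])+\mu_3(K_{u/v}),\qquad Q_{ij}=Q_{ii}+\Phi([\tilde\gamma_{j,i}])-2\Psi_{X^+}([\gamma_{j,i}])\quad(i\neq j).$$ **Proposition.** For all $i,j$, $$Q_{ij}=(2\Phi^2-\Psi^2_{X^+})([\gamma^{2,K}_{j,i}])+\mu_3(K_{u/v}).$$ Furthermore, $Q$ is symmetric: $Q_{ij}=Q_{ji}$ for all $i,j$. -/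

import Mathlib

/-! ## Winding numbers and the exponent-sum homomorphism of braid groups -/

/-- The punctured plane `ℂ ∖ {0}`. -/
abbrev PuncturedPlane : Type := {z : ℂ // z ≠ 0}

namespace Winding

open unitInterval

/-- A continuous logarithm along a path in `ℂ ∖ {0}`. -/
noncomputable def logLift {a b : PuncturedPlane} (γ : Path a b) : C(I, ℂ) :=
  Complex.isCoveringMap_exp.liftPath γ (Complex.log a)
    (by ext; simp [Complex.exp_log a.2])

theorem exp_logLift {a b : PuncturedPlane} (γ : Path a b) (t : I) :
    Complex.exp (logLift γ t) = (γ t : ℂ) :=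
  congrArg Subtype.val (congrFun (Complex.isCoveringMap_exp.liftPath_lifts γ.toContinuousMap
    (Complex.log a) (by ext; simp [Complex.exp_log a.2])) t)

/-- The total change of the logarithm along a path in `ℂ ∖ {0}`. -/
noncomputable def logIncrement {a b : PuncturedPlane} (γ : Path a b) : ℂ :=
  logLift γ 1 - logLift γ 0

/-- Any continuous logarithm along the path computes the total change. -/
theorem logIncrement_eq {a b : PuncturedPlane} (γ : Path a b) (L : C(I, ℂ))
    (hL : ∀ t, Complex.exp (L t) = (γ t : ℂ)) : logIncrement γ = L 1 - L 0 := by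
  set c : ℂ := logLift γ 0 - L 0 with hc
  have hcexp : Complex.exp c = 1 := by
    rw [hc, Complex.exp_sub, exp_logLift, hL]
    exact div_self (γ 0).2
  have key : logLift γ = L + ContinuousMap.const I c := by
    symm
    refine (Complex.isCoveringMap_exp.eq_liftPath_iff' _).mpr ⟨?_, ?_⟩
    · funext t
      ext
      simp [Complex.exp_add, hcexp, hL]
    · have h0 : logLift γ 0 = Complex.log a := Complex.isCoveringMap_exp.liftPath_zero _ _ _
      simp [hc, h0]
  rw [logIncrement, key]
  simp

theorem logIncrement_trans {a b c : PuncturedPlane} (γ : Path a b) (δ : Path b c) :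
    logIncrement (γ.trans δ) = logIncrement γ + logIncrement δ := by
  let L := logLift (γ.trans δ)
  have hL := exp_logLift (γ.trans δ)
  have h1 : logIncrement γ = L ⟨1 / 2, by norm_num, by norm_num⟩ - L 0 := by
    have := logIncrement_eq γ
      (L.comp ⟨fun t : I => ⟨t / 2, by have := t.2.1; positivity, by linarith [t.2.2]⟩,
        by fun_prop⟩) (fun t => by
          rw [ContinuousMap.comp_apply, hL, Path.trans_apply]
          have : ((⟨(t : ℝ) / 2, by have := t.2.1; positivity, by linarith [t.2.2]⟩ : I) : ℝ)
              ≤ 1 / 2 := by simp only; linarith [t.2.2]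
          simp only [ContinuousMap.coe_mk, this, dif_pos]
          congr 2
          ext
          simp only
          ring)
    rw [this]
    simp only [ContinuousMap.comp_apply]
    congr 2 <;> (ext; simp)
  have h2 : logIncrement δ = L 1 - L ⟨1 / 2, by norm_num, by norm_num⟩ := by
    have := logIncrement_eq δ
      (L.comp ⟨fun t : I => ⟨(1 + t) / 2, by have := t.2.1; positivity, by linarith [t.2.2]⟩,
        by fun_prop⟩) (fun t => by
          rw [ContinuousMap.comp_apply, hL, Path.trans_apply]
          simp only [ContinuousMap.coe_mk]
          split_ifs with h
          · have h0 : (t : ℝ) = 0 := le_antisymm (by linarith) t.2.1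
            have ht : t = 0 := Subtype.ext h0
            subst ht
            rw [Path.source]
            convert congrArg Subtype.val γ.target using 3
            ext
            simp
          · congr 2
            ext
            simp only
            ring)
    rw [this]
    simp only [ContinuousMap.comp_apply]
    congr 2 <;> (ext; norm_num)
  rw [h1, h2]
  simp only [logIncrement, L]
  ring

theorem logIncrement_homotopic {a b : PuncturedPlane} {γ δ : Path a b} (h : γ.Homotopic δ) :
    logIncrement γ = logIncrement δ := by
  have h0 : ∀ γ : Path a b, logLift γ 0 = Complex.log a := fun γ =>
    Complex.isCoveringMap_exp.liftPath_zero _ _ _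
  rw [logIncrement, logIncrement, h0, h0]
  congr 1
  exact Complex.isCoveringMap_exp.liftPath_apply_one_eq_of_homotopicRel h _ _ _

theorem exists_int {a : PuncturedPlane} (γ : Path a a) :
    ∃ n : ℤ, logIncrement γ = n * (2 * Real.pi * Complex.I) := by
  apply Complex.exp_eq_one_iff.mp
  rw [logIncrement, Complex.exp_sub, exp_logLift, exp_logLift, γ.source, γ.target]
  exact div_self a.2

/-- The (counterclockwise) winding number about `0` of a loop in `ℂ ∖ {0}`: a continuous logarithm
along the loop increases by `2πi` times this integer. -/
noncomputable def ofLoop {a : PuncturedPlane} (γ : Path a a) : ℤ := (exists_int γ).choose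

theorem logIncrement_eq_ofLoop {a : PuncturedPlane} (γ : Path a a) :
    logIncrement γ = ofLoop γ * (2 * Real.pi * Complex.I) := (exists_int γ).choose_spec

theorem ofLoop_eq_iff {a : PuncturedPlane} (γ : Path a a) (n : ℤ) :
    ofLoop γ = n ↔ logIncrement γ = n * (2 * Real.pi * Complex.I) := by
  rw [logIncrement_eq_ofLoop, mul_left_inj' Complex.two_pi_I_ne_zero, Int.cast_inj]

theorem ofLoop_homotopic {a : PuncturedPlane} {γ δ : Path a a} (h : γ.Homotopic δ) :
    ofLoop γ = ofLoop δ := by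
  rw [ofLoop_eq_iff, logIncrement_homotopic h, logIncrement_eq_ofLoop]

/-- The winding number as a homomorphism `π₁(ℂ ∖ {0}) → ℤ`. -/
noncomputable def hom (a : PuncturedPlane) : FundamentalGroup PuncturedPlane a →* Multiplicative ℤ where
  toFun γ := Multiplicative.ofAdd (Quotient.lift (fun δ : Path a a => ofLoop δ)
    (fun _ _ h => ofLoop_homotopic h) γ)
  map_one' := by
    change Multiplicative.ofAdd (ofLoop (Path.refl a)) = 1
    rw [ofAdd_eq_one, ofLoop_eq_iff,
      logIncrement_eq _ (ContinuousMap.const I (Complex.log a)) (by simp [Complex.exp_log a.2])]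
    simp
  map_mul' p q := by
    induction p using Quotient.inductionOn with | _ p =>
    induction q using Quotient.inductionOn with | _ q =>
    change Multiplicative.ofAdd (ofLoop (q.trans p)) =
      Multiplicative.ofAdd (ofLoop p) * Multiplicative.ofAdd (ofLoop q)
    rw [← ofAdd_add]
    congr 1
    rw [ofLoop_eq_iff, logIncrement_trans, logIncrement_eq_ofLoop, logIncrement_eq_ofLoop]
    push_cast
    ring

/-- The winding number of the homotopy class of a loop. -/
theorem hom_mk {a : PuncturedPlane} (γ : Path a a) :
    hom a (FundamentalGroup.fromPath (Path.Homotopic.Quotient.mk γ)) =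
      Multiplicative.ofAdd (ofLoop γ) := rfl

end Winding

/-! ## Unordered configuration spaces -/

/-- Ordered configurations of `n` distinct points of `X`. -/
abbrev OrdConf (n : ℕ) (X : Type) : Type := {f : Fin n → X // Function.Injective f}

/-- Two ordered configurations are identified if they differ by a relabelling of the points. -/
instance confSetoid (n : ℕ) (X : Type) : Setoid (OrdConf n X) where
  r f g := ∃ σ : Equiv.Perm (Fin n), ∀ k, g.1 k = f.1 (σ k)
  iseqv :=
    { refl := fun _ => ⟨1, fun _ => rfl⟩
      symm := fun ⟨σ, h⟩ => ⟨σ⁻¹, fun k => by simp [h]⟩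
      trans := fun ⟨σ, h⟩ ⟨τ, h'⟩ => ⟨σ * τ, fun k => by simp [h, h']⟩ }

/-- The configuration space `Conf^n(X)` of `n` distinct unordered points of `X`, with the quotient
topology. -/
def Conf (n : ℕ) (X : Type) : Type := Quotient (confSetoid n X)

instance (n : ℕ) (X : Type) [TopologicalSpace X] : TopologicalSpace (Conf n X) :=
  inferInstanceAs (TopologicalSpace (Quotient (confSetoid n X)))

namespace Conf

variable {X Y : Type} [TopologicalSpace X] [TopologicalSpace Y]

theorem continuous_coord {n : ℕ} (k : Fin n) : Continuous fun c : OrdConf n X => c.1 k :=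
  (continuous_apply k).comp continuous_subtype_val

/-- The quotient map from ordered to unordered configurations. -/
def mk (n : ℕ) (X : Type) [TopologicalSpace X] : C(OrdConf n X, Conf n X) :=
  ⟨Quotient.mk _, continuous_quot_mk⟩

/-- The map of configuration spaces induced by an injective continuous map. -/
def map (n : ℕ) (f : C(X, Y)) (hf : Function.Injective f) : C(Conf n X, Conf n Y) where
  toFun := Quotient.lift (fun c : OrdConf n X => mk n Y ⟨fun k => f (c.1 k), hf.comp c.2⟩)
    (fun _ _ ⟨σ, h⟩ => Quotient.sound ⟨σ, fun k => congrArg f (h k)⟩)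
  continuous_toFun := Continuous.quotient_lift ((mk n Y).continuous.comp (Continuous.subtype_mk
    (continuous_pi fun k => f.continuous.comp (continuous_coord k)) _)) _

/-- Adding the point `V` to a configuration in `ℂ ∖ {V}`. -/
noncomputable def addPoint (n : ℕ) (V : ℂ) : C(Conf n {z : ℂ // z ≠ V}, Conf (n + 1) ℂ) where
  toFun := Quotient.lift
    (fun c : OrdConf n {z : ℂ // z ≠ V} => mk (n + 1) ℂ
      ⟨Fin.cons V (fun k => (c.1 k : ℂ)), Fin.cons_injective_iff.mpr
        ⟨fun ⟨k, hk⟩ => (c.1 k).2 hk, Subtype.val_injective.comp c.2⟩⟩)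
    (fun _ _ ⟨σ, h⟩ => Quotient.sound
      ⟨Equiv.Perm.decomposeFin.symm (0, σ), fun k => by
        refine Fin.cases ?_ (fun k => ?_) k
        · simp
        · simp [h]⟩)
  continuous_toFun := Continuous.quotient_lift (by
    refine (mk (n + 1) ℂ).continuous.comp (Continuous.subtype_mk ?_ _)
    refine continuous_pi (fun k => ?_)
    refine Fin.cases ?_ (fun k => ?_) k
    · simpa using continuous_const
    · exact continuous_subtype_val.comp (continuous_coord k)) _

/-- The configuration of two distinct points. -/
def pair (a b : X) (h : a ≠ b) : Conf 2 X :=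
  mk 2 X ⟨![a, b], by
    intro k l hkl
    fin_cases k <;> fin_cases l <;> simp_all [h.symm]⟩

theorem pair_comm (a b : X) (h : a ≠ b) : pair a b h = pair b a h.symm :=
  Quotient.sound ⟨Equiv.swap 0 1, fun k => by fin_cases k <;> simp⟩

/-- Two paths that are at distinct points at all times give a path of configurations. -/
def pathPair {a b c d : X} (p : Path a b) (q : Path c d) (h : ∀ t, p t ≠ q t) (h0 : a ≠ c)
    (h1 : b ≠ d) : Path (pair a c h0) (pair b d h1) where
  toFun t := pair (p t) (q t) (h t)
  continuous_toFun := by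
    refine (mk 2 X).continuous.comp (Continuous.subtype_mk ?_ _)
    refine continuous_pi (fun k => ?_)
    fin_cases k
    · exact p.continuous
    · exact q.continuous
  source' := by simp
  target' := by simp

/-- The map sending a configuration `{z₁, …, zₙ}` in `ℂ` to `∏_{k ≠ l} (z_k - z_l)`, that is,
up to sign, to the discriminant `∏_{k < l} (z_k - z_l)²`. -/
noncomputable def disc (n : ℕ) : C(Conf n ℂ, PuncturedPlane) where
  toFun := Quotient.lift
    (fun c : OrdConf n ℂ => (⟨∏ k, ∏ l, if k = l then 1 else c.1 k - c.1 l, by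
      refine Finset.prod_ne_zero_iff.mpr fun k _ => Finset.prod_ne_zero_iff.mpr fun l _ => ?_
      split_ifs with h
      · exact one_ne_zero
      · exact sub_ne_zero.mpr (fun e => h (c.2 e))⟩ : PuncturedPlane))
    (fun c d ⟨σ, h⟩ => by
      ext
      simp only [h]
      rw [← Equiv.prod_comp σ]
      refine Finset.prod_congr rfl fun k _ => ?_
      rw [← Equiv.prod_comp σ]
      simp)
  continuous_toFun := Continuous.quotient_lift (by
    refine Continuous.subtype_mk ?_ _
    refine continuous_finsetProd _ fun k _ => continuous_finsetProd _ fun l _ => ?_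
    split_ifs
    · exact continuous_const
    · exact (continuous_coord k).sub (continuous_coord l)) _

end Conf

/-! ## Rational knots and their twist words -/

/-- A reduced fraction `u/v > 1` with `u` odd, i.e. a fraction for which the numerator closure
`K_{u/v}` of the rational tangle `τ_{u/v}` is a rational knot. -/
structure KnotFraction where
  u : ℕ
  v : ℕ
  odd_u : Odd u
  v_pos : 0 < v
  v_lt_u : v < u
  coprime : Nat.Coprime u v

namespace Twist

/-- The two twists: `T τ_{p/q} = τ_{(p+q)/q}` (top) and `R τ_{p/q} = τ_{p/(p+q)}` (right). -/
inductive Kind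
  | T
  | R

/-- The three orientations of the boundary of a rational tangle. -/
inductive Orientation
  | UP
  | OP
  | RI

/-- The sequence of twists building `τ_{p/q}` from `τ_{0/1}`, the last applied twist first. -/
def word (p q : ℕ) : List Kind :=
  if p = 0 ∨ q = 0 then []
  else if q ≤ p then .T :: word (p - q) q
  else .R :: word p (q - p)
termination_by p + q

/-- The fraction of the tangle built by a sequence of twists. -/
def fraction : List Kind → ℕ × ℕ
  | [] => (0, 1)
  | .T :: w => ((fraction w).1 + (fraction w).2, (fraction w).2)
  | .R :: w => ((fraction w).1, (fraction w).1 + (fraction w).2)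

/-- The effect of a twist on the orientation. -/
def act : Kind → Orientation → Orientation
  | .T, .UP => .UP
  | .T, .OP => .RI
  | .T, .RI => .OP
  | .R, .UP => .OP
  | .R, .OP => .UP
  | .R, .RI => .RI

/-- The orientation of the tangle built by a sequence of twists; `τ_{0/1}` has orientation `UP`. -/
def orientation : List Kind → Orientation
  | [] => .UP
  | t :: w => act t (orientation w)

/-- The contribution of applying a twist to a tangle of given orientation and fraction `p/q` to
`#{RUP, ROP⁻} - #{TOP⁺, TRI, RRI}`, where `OP⁺` means `OP` with `p > q` and `OP⁻` means `OP` with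
`p < q`. -/
def contribution : Kind → Orientation → ℕ × ℕ → ℤ
  | .R, .UP, _ => 1
  | .R, .OP, (p, q) => if p < q then 1 else 0
  | .R, .RI, _ => -1
  | .T, .UP, _ => 0
  | .T, .OP, (p, q) => if q < p then -1 else 0
  | .T, .RI, _ => -1

/-- `#{RUP, ROP⁻} - #{TOP⁺, TRI, RRI}`, counting the twists in a sequence of twists. -/
def count : List Kind → ℤ
  | [] => 0
  | t :: w => count w + contribution t (orientation w) (fraction w)

end Twist

namespace KnotFraction

variable (F : KnotFraction)

/-- The correction term `μ₃(K_{u/v}) = #{RUP, ROP⁻} - #{TOP⁺, TRI, RRI}`, counting the twists used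
to build `τ_{(u-v)/v}`. -/
def mu3 : ℤ := Twist.count (Twist.word (F.u - F.v) F.v)

/-- The picture `𝒟(K_{u/v})` is drawn as follows. The punctures lie on the real axis: `X⁻` at `0`, and
`Y` and `X⁺` at `2v` and `2(u+v)`, where `X⁺` is on the right if `v` is odd (then `τ_{u/v}` has
orientation `UP`) and in the middle if `v` is even (orientation `OP`); `β` is the segment
`(2v, 2(u+v))` between `Y` and `X⁺`. All arcs of the upper half plane are semicircles centred above
`2v`, and those of the lower half plane are semicircles centred below `0` (between positions in
`(-2u, 2u)`) or below `2(u+v)` (between positions in `(2u, 2u+4v)`). The arc `α_{u/v}` from `X⁻` to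
`X⁺` is obtained by starting at `0` and following these semicircles; it crosses the real axis at the
multiples of `4` in `(-2u, 2u+4v)`, and so meets `(-∞, 0)`, `(0, 2v)`, `β` and `(2(u+v), ∞)` in the
same order as the two-bridge diagram in which the label `m` on one of two parallel
segments, labelled clockwise by `ℤ/2u`, is joined to the label `v - m` on the other one. The
boundary `ᾱ_{u/v}` of a thin band around it crosses the real axis at the odd positions in
`(-2u, 2u+4v)`; it starts here at `1`, next to `X⁻`, going upwards.

`F.strand k` is the position of the `k`-th crossing of `ᾱ_{u/v}` with the real axis, in the order in
which they are met. -/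
def strand : ℕ → ℤ
  | 0 => 1
  | k + 1 =>
    if Even k then 4 * F.v - strand k
    else if |strand k| < 2 * F.u then - strand k
    else 4 * (F.u + F.v) - strand k

theorem strand_odd (k : ℕ) : Odd (F.strand k) := by
  induction k with
  | zero => exact odd_one
  | succ k ih =>
    obtain ⟨c, hc⟩ := ih
    rw [strand]
    split_ifs
    · exact ⟨2 * F.v - c - 1, by rw [hc]; ring⟩
    · exact ⟨- c - 1, by rw [hc]; ring⟩
    · exact ⟨2 * (F.u + F.v) - c - 1, by rw [hc]; ring⟩

theorem strand_mem (k : ℕ) :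
    -(2 * (F.u : ℤ)) < F.strand k ∧ F.strand k < 2 * F.u + 4 * F.v := by
  have hv := F.v_pos
  have hu := F.v_lt_u
  induction k with
  | zero => simp only [strand]; omega
  | succ k ih =>
    obtain ⟨c, hc⟩ := F.strand_odd k
    rw [strand]
    split_ifs with h1 h2
    · omega
    · rw [abs_lt] at h2; omega
    · rw [abs_lt] at h2; omega

theorem strand_two_mul (m : ℕ) :
    ∃ c : ℤ, F.strand (2 * m) = 1 - 4 * F.v * m + 4 * (F.u + F.v) * c := by
  induction m with
  | zero => exact ⟨0, by simp [strand]⟩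
  | succ m ih =>
    obtain ⟨c, hc⟩ := ih
    have h1 : F.strand (2 * m + 1) = 4 * F.v - F.strand (2 * m) := by
      rw [strand, if_pos (even_two_mul m)]
    have h2 : ¬ Even (2 * m + 1) := by simp
    rw [show 2 * (m + 1) = (2 * m + 1) + 1 by ring, strand, if_neg h2, h1]
    split_ifs
    · exact ⟨c, by rw [hc]; push_cast; ring⟩
    · exact ⟨c + 1, by rw [hc]; push_cast; ring⟩

theorem strand_two_mul_add_one (m : ℕ) :
    F.strand (2 * m + 1) = 4 * F.v - F.strand (2 * m) := by
  rw [strand, if_pos (even_two_mul m)]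

/-- The curve passes through each position once. -/
theorem strand_injOn {k l : ℕ} (hk : k < 2 * (F.u + F.v)) (hl : l < 2 * (F.u + F.v))
    (h : F.strand k = F.strand l) : k = l := by
  have hcop : IsCoprime ((F.u + F.v : ℤ)) (F.v : ℤ) := by
    have : Nat.Coprime (F.u + F.v) F.v := by simpa using F.coprime
    exact_mod_cast Nat.isCoprime_iff_coprime.mpr this
  have key : ∀ m n : ℕ, m < F.u + F.v → n < F.u + F.v →
      F.strand (2 * m) = F.strand (2 * n) → m = n := by
    intro m n hm hn e
    obtain ⟨c, hc⟩ := F.strand_two_mul m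
    obtain ⟨d, hd⟩ := F.strand_two_mul n
    have hdvd : ((F.u + F.v : ℤ)) ∣ F.v * ((m : ℤ) - n) := ⟨c - d, by linarith⟩
    have := hcop.dvd_of_dvd_mul_left hdvd
    have h0 : (m : ℤ) - n = 0 := by
      apply Int.eq_zero_of_abs_lt_dvd this
      rw [abs_lt]
      constructor <;> omega
    omega
  obtain ⟨m, rfl | rfl⟩ := Nat.even_or_odd' k <;> obtain ⟨n, rfl | rfl⟩ := Nat.even_or_odd' l
  · rw [key m n (by omega) (by omega) h]
  · exfalso
    rw [strand_two_mul_add_one] at h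
    obtain ⟨c, hc⟩ := F.strand_two_mul m
    obtain ⟨d, hd⟩ := F.strand_two_mul n
    have : (4 : ℤ) ∣ 2 := ⟨F.v * m + F.v * n + F.v - (F.u + F.v) * (c + d), by linarith⟩
    omega
  · exfalso
    rw [strand_two_mul_add_one] at h
    obtain ⟨c, hc⟩ := F.strand_two_mul m
    obtain ⟨d, hd⟩ := F.strand_two_mul n
    have : (4 : ℤ) ∣ 2 := ⟨F.v * m + F.v * n + F.v - (F.u + F.v) * (c + d), by linarith⟩
    omega
  · rw [strand_two_mul_add_one, strand_two_mul_add_one] at h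
    rw [key m n (by omega) (by omega) (by linarith)]

theorem exists_strand_eq (n : Fin F.u) :
    ∃ k, k < 2 * (F.u + F.v) ∧ F.strand k = 2 * F.v + 1 + 2 * (n : ℕ) := by
  have hmem := F.strand_mem
  have hlt : ∀ k : Fin (2 * (F.u + F.v)),
      ((F.strand k + 2 * F.u - 1) / 2).toNat < 2 * (F.u + F.v) := by
    intro k
    have := hmem k
    omega
  let f : Fin (2 * (F.u + F.v)) → Fin (2 * (F.u + F.v)) := fun k => ⟨_, hlt k⟩
  have hinj : Function.Injective f := by
    intro k l h
    have h' : ((F.strand k + 2 * F.u - 1) / 2).toNat = ((F.strand l + 2 * F.u - 1) / 2).toNat :=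
      congrArg Fin.val h
    obtain ⟨a, ha⟩ := F.strand_odd k
    obtain ⟨b, hb⟩ := F.strand_odd l
    have := hmem k
    have := hmem l
    exact Fin.ext (F.strand_injOn k.2 l.2 (by omega))
  obtain ⟨k, hk⟩ := Finite.injective_iff_surjective.mp hinj
    ⟨F.u + F.v + n, by have := n.2; omega⟩
  refine ⟨k, k.2, ?_⟩
  have hk' : ((F.strand k + 2 * F.u - 1) / 2).toNat = F.u + F.v + n := congrArg Fin.val hk
  obtain ⟨a, ha⟩ := F.strand_odd k
  have := hmem k
  omega

/-- The intersection points `κ_0, …, κ_{u-1}` of `ᾱ_{u/v}` and `β`, numbered from left to right: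
`κ_n` lies at position `2v + 1 + 2n`, and `F.kappa n` is its place in the order in which the curve
`ᾱ_{u/v}` meets the real axis. -/
def kappa (n : Fin F.u) : ℕ := Nat.find (F.exists_strand_eq n)

theorem kappa_lt (n : Fin F.u) : F.kappa n < 2 * (F.u + F.v) :=
  (Nat.find_spec (F.exists_strand_eq n)).1

theorem strand_kappa (n : Fin F.u) : F.strand (F.kappa n) = 2 * F.v + 1 + 2 * (n : ℕ) :=
  (Nat.find_spec (F.exists_strand_eq n)).2

/-- The index of the intersection point `κ_ω` next to the puncture `X⁺`. -/
def kappaOmega : Fin F.u :=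
  if Even F.v then ⟨0, by have := F.v_lt_u; omega⟩ else ⟨F.u - 1, by have := F.v_lt_u; omega⟩

end KnotFraction

/-! ## The picture in the three-punctured plane -/

/-- The names of the three punctures. -/
inductive Puncture
  | Xplus
  | Xminus
  | Y
  deriving DecidableEq

namespace KnotFraction

variable (F : KnotFraction)

/-- The positions of the punctures on the real axis. -/
def position : Puncture → ℤ
  | .Xminus => 0
  | .Xplus => if Even F.v then 2 * F.v else 2 * (F.u + F.v)
  | .Y => if Even F.v then 2 * (F.u + F.v) else 2 * F.v

/-- The three-punctured plane `M = ℂ ∖ {X⁺, X⁻, Y}`. -/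
abbrev M : Type := {z : ℂ // ∀ p, z ≠ (F.position p : ℂ)}

theorem position_even (p : Puncture) : Even (F.position p) := by
  cases p <;> simp only [position]
  · split_ifs <;> exact even_two_mul _
  · exact Even.zero
  · split_ifs <;> exact even_two_mul _

theorem position_cases (p : Puncture) :
    F.position p = 0 ∨ F.position p = 2 * F.v ∨ F.position p = 2 * (F.u + F.v) := by
  cases p <;> simp only [position]
  · split_ifs <;> simp
  · simp
  · split_ifs <;> simp

theorem strand_ne_position (k : ℕ) (p : Puncture) :
    ((F.strand k : ℤ) : ℝ) ≠ ((F.position p : ℤ) : ℝ) := by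
  intro h
  have h' : F.strand k = F.position p := by exact_mod_cast h
  exact (Int.not_even_iff_odd.mpr (F.strand_odd k)) (h' ▸ F.position_even p)

theorem ne_position_of_re {z : ℂ} {p : Puncture} (h : z.re ≠ ((F.position p : ℤ) : ℝ)) :
    z ≠ (F.position p : ℂ) := by
  rintro rfl
  simp at h

theorem ne_position_of_im {z : ℂ} {p : Puncture} (h : z.im ≠ 0) :
    z ≠ (F.position p : ℂ) := by
  rintro rfl
  simp at h

/-- The point of `M` at height `y` over the position of the `k`-th crossing of the real axis. -/
def pt (k : ℕ) (y : ℝ) : F.M :=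
  ⟨⟨F.strand k, y⟩, fun p => F.ne_position_of_re (F.strand_ne_position k p)⟩

/-- The heights `1` (for `β₁`, the top copy of `β`) and `-1` (for `β₂`, the bottom copy). -/
def height (top : Bool) : ℝ := if top then 1 else -1

/-- Whether the `n`-th vertex lies on the line `Im = 1` (or on the line `Im = -1`). -/
def onTop (n : ℕ) : Bool := decide (n % 4 = 1 ∨ n % 4 = 2)

/-- The curve `ᾱ_{u/v}` meets the lines `Im = ±1` in the vertices: the `k`-th strand of the curve,
a vertical segment through the real axis, runs from vertex `2k` to vertex `2k + 1`. -/
def vertex (n : ℕ) : F.M := F.pt (n / 2) (height (onTop n))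

/-- The piece of `ᾱ_{u/v}` from vertex `n` to vertex `n + 1`: a vertical segment if `n` is even,
and a semicircle above the line `Im = 1` or below the line `Im = -1` if `n` is odd. -/
noncomputable def stepFun (n : ℕ) (t : ℝ) : ℂ :=
  ⟨((F.strand (n / 2) : ℝ) + F.strand ((n + 1) / 2)) / 2 +
      ((F.strand (n / 2) : ℝ) - F.strand ((n + 1) / 2)) / 2 * Real.cos (Real.pi * t),
    height (onTop n) * (if Even n then 1 - 2 * t
      else 1 + |(F.strand (n / 2) : ℝ) - F.strand ((n + 1) / 2)| / 2 * Real.sin (Real.pi * t))⟩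

theorem height_mul_self (b : Bool) : height b * height b = 1 := by
  cases b <;> norm_num [height]

theorem height_ne_zero (b : Bool) : height b ≠ 0 := by
  cases b <;> norm_num [height]

theorem height_not (b : Bool) : height (!b) = -height b := by
  cases b <;> norm_num [height]

theorem height_injective {b c : Bool} (h : height b = height c) : b = c := by
  cases b <;> cases c <;> norm_num [height] at h <;> rfl

theorem onTop_succ_of_even {n : ℕ} (h : Even n) : onTop (n + 1) = !onTop n := by
  rw [Nat.even_iff] at h
  simp only [onTop, ← decide_not, decide_eq_decide]
  omega

theorem onTop_succ_of_odd {n : ℕ} (h : ¬ Even n) : onTop (n + 1) = onTop n := by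
  rw [Nat.even_iff] at h
  simp only [onTop, decide_eq_decide]
  omega

theorem sin_nonneg_of_unit {t : ℝ} (h0 : 0 ≤ t) (h1 : t ≤ 1) : 0 ≤ Real.sin (Real.pi * t) :=
  Real.sin_nonneg_of_nonneg_of_le_pi (by positivity) (by nlinarith [Real.pi_pos])

theorem strand_ne_succ (k : ℕ) : F.strand k ≠ F.strand (k + 1) := by
  intro h
  obtain ⟨c, hc⟩ := F.strand_odd k
  rw [strand] at h
  split_ifs at h <;> omega

theorem stepFun_ne_position (n : ℕ) {t : ℝ} (h0 : 0 ≤ t) (h1 : t ≤ 1) (p : Puncture) :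
    F.stepFun n t ≠ (F.position p : ℂ) := by
  by_cases h : Even n
  · apply F.ne_position_of_re
    have : (n + 1) / 2 = n / 2 := by obtain ⟨m, rfl⟩ := h; omega
    simp only [stepFun, this, sub_self, zero_div, zero_mul, add_zero, add_self_div_two]
    exact F.strand_ne_position _ p
  · apply F.ne_position_of_im
    simp only [stepFun, if_neg h]
    refine mul_ne_zero (height_ne_zero _) ?_
    have := sin_nonneg_of_unit h0 h1
    positivity

/-- The piece of `ᾱ_{u/v}` from vertex `n` to vertex `n + 1`, as a path in `M`. -/
noncomputable def step (n : ℕ) : Path (F.vertex n) (F.vertex (n + 1)) where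
  toFun t := ⟨F.stepFun n t, F.stepFun_ne_position n t.2.1 t.2.2⟩
  continuous_toFun := by
    refine Continuous.subtype_mk ?_ _
    have : ∀ x y : ℝ, (⟨x, y⟩ : ℂ) = x + y * Complex.I := Complex.mk_eq_add_mul_I
    simp only [stepFun, this]
    split_ifs <;> fun_prop
  source' := by
    apply Subtype.ext
    simp only [stepFun, vertex, pt, Set.Icc.coe_zero, mul_zero, Real.cos_zero, Real.sin_zero]
    apply Complex.ext
    · simp only; ring
    · simp
  target' := by
    apply Subtype.ext
    simp only [stepFun, vertex, pt, Set.Icc.coe_one, mul_one, Real.cos_pi, Real.sin_pi]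
    apply Complex.ext
    · simp only; ring
    · by_cases h : Even n
      · simp only [if_pos h, onTop_succ_of_even h, height_not]; ring
      · simp only [if_neg h, onTop_succ_of_odd h]; ring

/-- A vertical segment of a strand. -/
def vertical (k : ℕ) (y y' : ℝ) : Path (F.pt k y) (F.pt k y') where
  toFun t := F.pt k ((1 - t) * y + t * y')
  continuous_toFun := by
    refine Continuous.subtype_mk ?_ _
    simp only [Complex.mk_eq_add_mul_I]
    fun_prop
  source' := by simp
  target' := by simp

/-- The horizontal segment at height `y` between two strands; at height `0` both strands are
required to cross `β`. -/
def horizontal (k l : ℕ) (y : ℝ)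
    (h : y ≠ 0 ∨ ((2 * F.v < F.strand k ∧ F.strand k < 2 * (F.u + F.v)) ∧
      2 * F.v < F.strand l ∧ F.strand l < 2 * (F.u + F.v))) : Path (F.pt k y) (F.pt l y) where
  toFun t := ⟨⟨(1 - t) * F.strand k + t * F.strand l, y⟩, fun p => by
    rcases h with h | ⟨⟨h1, h2⟩, h3, h4⟩
    · exact F.ne_position_of_im h
    · apply F.ne_position_of_re
      have h1' : (2 * F.v : ℝ) < F.strand k := by exact_mod_cast h1
      have h2' : (F.strand k : ℝ) < 2 * (F.u + F.v) := by exact_mod_cast h2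
      have h3' : (2 * F.v : ℝ) < F.strand l := by exact_mod_cast h3
      have h4' : (F.strand l : ℝ) < 2 * (F.u + F.v) := by exact_mod_cast h4
      have hu : (0 : ℝ) ≤ F.u := Nat.cast_nonneg _
      have hv : (0 : ℝ) ≤ F.v := Nat.cast_nonneg _
      have lo : (2 * F.v : ℝ) < (1 - t : ℝ) * F.strand k + t * F.strand l := by
        nlinarith [t.2.1, t.2.2, mul_nonneg t.2.1 (sub_nonneg.mpr h3'.le),
          mul_nonneg (sub_nonneg.mpr t.2.2) (sub_nonneg.mpr h1'.le)]
      have hi : (1 - t : ℝ) * F.strand k + t * F.strand l < 2 * (F.u + F.v) := by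
        nlinarith [t.2.1, t.2.2, mul_nonneg t.2.1 (sub_nonneg.mpr h4'.le),
          mul_nonneg (sub_nonneg.mpr t.2.2) (sub_nonneg.mpr h2'.le)]
      rcases F.position_cases p with e | e | e <;> rw [e] <;> push_cast
      · exact ne_of_gt (by linarith)
      · exact ne_of_gt lo
      · exact ne_of_lt hi⟩
  continuous_toFun := by
    refine Continuous.subtype_mk ?_ _
    simp only [Complex.mk_eq_add_mul_I]
    fun_prop
  source' := by simp [pt]
  target' := by simp [pt]

/-- The path along `ᾱ_{u/v}` from vertex `n` to vertex `n + d`. -/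
noncomputable def alongAux (n : ℕ) : (d : ℕ) → Path (F.vertex n) (F.vertex (n + d))
  | 0 => Path.refl _
  | d + 1 => (alongAux n d).trans (F.step (n + d))

/-- The path along `ᾱ_{u/v}` from vertex `n` to vertex `m`, for `n ≤ m`. -/
noncomputable def along (n m : ℕ) (h : n ≤ m) : Path (F.vertex n) (F.vertex m) :=
  (F.alongAux n (m - n)).cast rfl (by rw [Nat.add_sub_cancel' h])

/-! ### The curve is embedded -/

theorem coe_step (n : ℕ) (t : unitInterval) : ((F.step n t : F.M) : ℂ) = F.stepFun n t := rfl

theorem half_width_pos (n : ℕ) (h : ¬ Even n) :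
    0 < |(F.strand (n / 2) : ℝ) - F.strand ((n + 1) / 2)| / 2 := by
  have hn : (n + 1) / 2 = n / 2 + 1 := by rw [Nat.even_iff] at h; omega
  have : ((F.strand (n / 2) : ℤ) : ℝ) ≠ F.strand ((n + 1) / 2) := by
    rw [hn]
    exact_mod_cast F.strand_ne_succ (n / 2)
  have := abs_pos.mpr (sub_ne_zero.mpr this)
  positivity

theorem step_ne_vertex {n c : ℕ} (hn : n + 1 < 4 * (F.u + F.v)) (hc : c < 4 * (F.u + F.v))
    (h1 : c ≠ n) (h2 : c ≠ n + 1) (t : unitInterval) : F.step n t ≠ F.vertex c := by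
  intro e
  have e' : F.stepFun n t = ⟨F.strand (c / 2), height (onTop c)⟩ := congrArg Subtype.val e
  have hre := congrArg Complex.re e'
  have him := congrArg Complex.im e'
  by_cases h : Even n
  · have hn2 : (n + 1) / 2 = n / 2 := by rw [Nat.even_iff] at h; omega
    simp only [stepFun, hn2, sub_self, zero_div, zero_mul, add_zero, add_self_div_two] at hre
    have := F.strand_injOn (k := n / 2) (l := c / 2) (by omega) (by omega) (by exact_mod_cast hre)
    rw [Nat.even_iff] at h
    omega
  · simp only [stepFun, if_neg h] at him hre
    have hr := F.half_width_pos n h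
    have hs := sin_nonneg_of_unit t.2.1 t.2.2
    set r := |(F.strand (n / 2) : ℝ) - F.strand ((n + 1) / 2)| / 2 with hrdef
    have hrs : 0 ≤ r * Real.sin (Real.pi * t) := by positivity
    have htop : onTop n = onTop c := by
      rcases hb : onTop n <;> rcases hb' : onTop c <;> simp [hb, hb', height] at him ⊢ <;> linarith
    rw [htop] at him
    have hs0 : Real.sin (Real.pi * t) = 0 := by
      have : r * Real.sin (Real.pi * t) = 0 := by
        have := mul_left_cancel₀ (height_ne_zero (onTop c)) (him.trans (mul_one _).symm)
        linarith
      exact (mul_eq_zero.mp this).resolve_left hr.ne'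
    have hcos := Real.sin_sq_add_cos_sq (Real.pi * t)
    rw [hs0, sq, zero_mul, zero_add, sq] at hcos
    have hodd := h
    rw [Nat.even_iff] at hodd
    rcases mul_self_eq_one_iff.mp hcos with hc1 | hc1
    · rw [hc1] at hre
      have hre' : (F.strand (n / 2) : ℝ) = F.strand (c / 2) := by linarith
      have := F.strand_injOn (k := n / 2) (l := c / 2) (by omega) (by omega)
        (by exact_mod_cast hre')
      have hcn : n = c + 1 := by omega
      have hce : Even c := by rw [Nat.even_iff]; omega
      rw [hcn, onTop_succ_of_even hce] at htop
      simp at htop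
    · rw [hc1] at hre
      have hre' : (F.strand ((n + 1) / 2) : ℝ) = F.strand (c / 2) := by linarith
      have := F.strand_injOn (k := (n + 1) / 2) (l := c / 2) (by omega) (by omega)
        (by exact_mod_cast hre')
      have hcn : c = n + 1 + 1 := by omega
      have hce : Even (n + 1) := by rw [Nat.even_iff]; omega
      rw [hcn, onTop_succ_of_even hce, onTop_succ_of_odd h] at htop
      simp at htop

theorem vertex_injOn {n c : ℕ} (hn : n < 4 * (F.u + F.v)) (hc : c < 4 * (F.u + F.v))
    (e : F.vertex n = F.vertex c) : n = c := by
  have e' : (⟨F.strand (n / 2), height (onTop n)⟩ : ℂ) = ⟨F.strand (c / 2), height (onTop c)⟩ :=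
    congrArg Subtype.val e
  have hre : (F.strand (n / 2) : ℝ) = F.strand (c / 2) := congrArg Complex.re e'
  have htop := height_injective (congrArg Complex.im e')
  have := F.strand_injOn (k := n / 2) (l := c / 2) (by omega) (by omega) (by exact_mod_cast hre)
  simp only [onTop, decide_eq_decide] at htop
  omega

theorem alongAux_ne_vertex {n c : ℕ} (hc : c < 4 * (F.u + F.v)) (d : ℕ)
    (hd : n + d < 4 * (F.u + F.v)) (h : c < n ∨ n + d < c) (t : unitInterval) :
    F.alongAux n d t ≠ F.vertex c := by
  induction d generalizing t with
  | zero =>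
    intro e
    have := F.vertex_injOn (n := n) (c := c) (by omega) hc e
    omega
  | succ d ih =>
    rw [alongAux, Path.trans_apply]
    split_ifs
    · exact ih (by omega) (by omega) _
    · exact F.step_ne_vertex (by omega) hc (by omega) (by omega) _

theorem along_ne_vertex {n m c : ℕ} (h : n ≤ m) (hc : c < 4 * (F.u + F.v))
    (hm : m < 4 * (F.u + F.v)) (hcn : c < n ∨ m < c) (t : unitInterval) :
    F.along n m h t ≠ F.vertex c :=
  F.alongAux_ne_vertex hc (m - n) (by omega) (by omega) t

theorem step_ne_step_succ (n : ℕ) (t : unitInterval) : F.step n t ≠ F.step (n + 1) t := by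
  intro e
  have e' : F.stepFun n t = F.stepFun (n + 1) t := congrArg Subtype.val e
  have hre := congrArg Complex.re e'
  have him := congrArg Complex.im e'
  have hs := sin_nonneg_of_unit t.2.1 t.2.2
  have ht0 := t.2.1
  have ht1 := t.2.2
  by_cases h : Even n
  · have h' : ¬ Even (n + 1) := by rw [Nat.even_iff] at *; omega
    have hn : (n + 1) / 2 = n / 2 := by rw [Nat.even_iff] at h; omega
    have hn' : (n + 1 + 1) / 2 = n / 2 + 1 := by rw [Nat.even_iff] at h; omega
    have hr := F.half_width_pos (n + 1) h'
    simp only [stepFun, if_pos h, if_neg h', onTop_succ_of_even h, height_not] at him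
    set r := |(F.strand ((n + 1) / 2) : ℝ) - F.strand ((n + 1 + 1) / 2)| / 2
    have hrs : 0 ≤ r * Real.sin (Real.pi * t) := by positivity
    have h1 : (1 - 2 * t : ℝ) = -(1 + r * Real.sin (Real.pi * t)) :=
      mul_left_cancel₀ (height_ne_zero (onTop n)) (by linarith)
    have ht : (t : ℝ) = 1 := by linarith
    simp only [stepFun, hn, hn', ht, mul_one, Real.cos_pi] at hre
    have : (F.strand (n / 2) : ℝ) = F.strand (n / 2 + 1) := by linarith
    exact F.strand_ne_succ _ (by exact_mod_cast this)
  · have h' : Even (n + 1) := by rw [Nat.even_iff] at *; omega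
    have hn : (n + 1) / 2 = n / 2 + 1 := by rw [Nat.even_iff] at h; omega
    have hn' : (n + 1 + 1) / 2 = n / 2 + 1 := by rw [Nat.even_iff] at h; omega
    have hr := F.half_width_pos n h
    simp only [stepFun, if_neg h, if_pos h', onTop_succ_of_odd h] at him
    set r := |(F.strand (n / 2) : ℝ) - F.strand ((n + 1) / 2)| / 2
    have hrs : 0 ≤ r * Real.sin (Real.pi * t) := by positivity
    have h1 : (1 + r * Real.sin (Real.pi * t) : ℝ) = 1 - 2 * t :=
      mul_left_cancel₀ (height_ne_zero (onTop n)) him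
    have ht : (t : ℝ) = 0 := by linarith
    simp only [stepFun, hn, hn', ht, mul_zero, Real.cos_zero] at hre
    have : (F.strand (n / 2) : ℝ) = F.strand (n / 2 + 1) := by linarith
    exact F.strand_ne_succ _ (by exact_mod_cast this)

theorem vertex_ne_succ (n : ℕ) : F.vertex n ≠ F.vertex (n + 1) := by
  simpa using F.step_ne_step_succ n 0

end KnotFraction

/-! ## The loops -/

namespace KnotFraction

variable (F : KnotFraction)

/-- The half of the `k`-th strand from the real axis to its final vertex. -/
noncomputable def halfOut (k : ℕ) : Path (F.pt k 0) (F.vertex (2 * k + 1)) :=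
  (F.vertical k 0 (height (onTop (2 * k + 1)))).cast rfl
    (by rw [vertex, show (2 * k + 1) / 2 = k by omega])

/-- The half of the `k`-th strand from its initial vertex to the real axis. -/
noncomputable def halfIn (k : ℕ) : Path (F.vertex (2 * k)) (F.pt k 0) :=
  (F.vertical k (height (onTop (2 * k))) 0).cast
    (by rw [vertex, show 2 * k / 2 = k by omega]) rfl

/-- The path along `ᾱ_{u/v}` from the crossing of the `k`-th strand with the real axis to that of
the `l`-th strand, for `k < l`. -/
noncomputable def forward (k l : ℕ) (h : k < l) : Path (F.pt k 0) (F.pt l 0) :=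
  ((F.halfOut k).trans (F.along (2 * k + 1) (2 * l) (by omega))).trans (F.halfIn l)

/-- The path `η_{j,i}` along `ᾱ_{u/v}` from `κ_j` to `κ_i` which avoids the part of `ᾱ_{u/v}` around
`X⁻` (the semicircle of radius `1` below `X⁻ = 0`, which joins the last vertex to vertex `0`). -/
noncomputable def eta (j i : Fin F.u) : Path (F.pt (F.kappa j) 0) (F.pt (F.kappa i) 0) :=
  if h : F.kappa j < F.kappa i then F.forward _ _ h
  else if h' : F.kappa i < F.kappa j then (F.forward _ _ h').symm
  else (Path.refl _).cast rfl (by rw [show F.kappa i = F.kappa j by omega])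

theorem kappa_mem (n : Fin F.u) :
    2 * F.v < F.strand (F.kappa n) ∧ F.strand (F.kappa n) < 2 * (F.u + F.v) := by
  have := F.strand_kappa n
  have := n.2
  omega

/-- The loop `γ_{j,i}` in `M`: from `κ_j` to `κ_i` along `ᾱ_{u/v}`, and back along `β`. -/
noncomputable def gamma (j i : Fin F.u) : Path (F.pt (F.kappa j) 0) (F.pt (F.kappa j) 0) :=
  (F.eta j i).trans (F.horizontal (F.kappa i) (F.kappa j) 0 (Or.inr ⟨F.kappa_mem i, F.kappa_mem j⟩))

theorem pt_ne_of_height (k l : ℕ) {y y' : ℝ} (h : y ≠ y') : F.pt k y ≠ F.pt l y' := by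
  intro e
  exact h (congrArg (fun z : F.M => (z : ℂ).im) e)

theorem height_ne_height_not (b : Bool) : height b ≠ height (!b) := by
  rw [height_not]
  have := height_ne_zero b
  intro h
  apply this
  linarith

/-- The configuration with one point at height `height b` on the `k`-th strand and the other at the
opposite height on the `l`-th strand. -/
noncomputable def config (k l : ℕ) (b : Bool) : Conf 2 F.M :=
  Conf.pair (F.pt k (height b)) (F.pt l (height !b)) (F.pt_ne_of_height k l (height_ne_height_not b))

/-- The base point for the pair `κ_j, κ_i`: the point further to the left is placed on the top copy
`β₁` of `β`, the other one on the bottom copy `β₂`. (For `j = i` there is a point on each.) -/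
noncomputable def base (j i : Fin F.u) : Conf 2 F.M := F.config (F.kappa j) (F.kappa i) (decide (j < i))

/-- The configuration in which `κ_i` is on both copies of `β`. -/
noncomputable def both (i : Fin F.u) : Conf 2 F.M := F.config (F.kappa i) (F.kappa i) true

theorem config_not (k l : ℕ) (b : Bool) : F.config k l (!b) = F.config l k b := by
  rw [config, config, Conf.pair_comm]
  simp only [Bool.not_not]

theorem config_self (k : ℕ) (b : Bool) : F.config k k b = F.config k k true := by
  cases b
  · exact F.config_not k k true
  · rfl

/-- The index of the vertex at height `height b` on the `k`-th strand. -/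
def idx (k : ℕ) (b : Bool) : ℕ := if onTop (2 * k) = b then 2 * k else 2 * k + 1

theorem idx_bounds (k : ℕ) (b : Bool) : 2 * k ≤ idx k b ∧ idx k b ≤ 2 * k + 1 := by
  rw [idx]
  split_ifs <;> omega

theorem vertex_idx (k : ℕ) (b : Bool) : F.vertex (idx k b) = F.pt k (height b) := by
  rw [idx]
  split_ifs with h
  · rw [vertex, h, show 2 * k / 2 = k by omega]
  · rw [vertex, onTop_succ_of_even (even_two_mul k), show (2 * k + 1) / 2 = k by omega]
    cases b <;> simp_all

theorem pair_vertex_eq (k l : ℕ) (b : Bool) (h : F.vertex (idx k b) ≠ F.vertex (idx l !b)) :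
    Conf.pair (F.vertex (idx k b)) (F.vertex (idx l !b)) h = F.config k l b := by
  simp only [config, vertex_idx]

theorem pair_strand_eq (k : ℕ) (h : F.vertex (2 * k) ≠ F.vertex (2 * k + 1)) :
    Conf.pair (F.vertex (2 * k)) (F.vertex (2 * k + 1)) h = F.config k k true := by
  have h1 : F.vertex (2 * k) = F.pt k (height (onTop (2 * k))) := by
    rw [vertex, show 2 * k / 2 = k by omega]
  have h2 : F.vertex (2 * k + 1) = F.pt k (height !(onTop (2 * k))) := by
    rw [vertex, onTop_succ_of_even (even_two_mul k), show (2 * k + 1) / 2 = k by omega]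
  rw [← F.config_self k (onTop (2 * k))]
  simp only [config, h1, h2]

/-- One point is at vertex `a` and another one at vertex `c` of the `f`-th strand, `a` lying before
that strand. The point at `c` moves along `ᾱ_{u/v}` to the end of the `f`-th strand (this is constant
if it is there already), and then the point at `a` moves along `ᾱ_{u/v}` to its beginning. -/
noncomputable def slideForward (a c f : ℕ) (hf : f < 2 * (F.u + F.v)) (ha : a < 2 * f)
    (hc : 2 * f ≤ c ∧ c ≤ 2 * f + 1) (hac : F.vertex a ≠ F.vertex c) :
    Path (Conf.pair (F.vertex a) (F.vertex c) hac)
      (Conf.pair (F.vertex (2 * f)) (F.vertex (2 * f + 1)) (F.vertex_ne_succ _)) :=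
  (Conf.pathPair (Path.refl (F.vertex a)) (F.along c (2 * f + 1) hc.2)
    (fun t => (F.along_ne_vertex hc.2 (by omega) (by omega) (by omega) t).symm) hac
    (fun e => by have := F.vertex_injOn (by omega) (by omega) e; omega)).trans
  (Conf.pathPair (F.along a (2 * f) ha.le) (Path.refl (F.vertex (2 * f + 1)))
    (fun t => F.along_ne_vertex ha.le (by omega) (by omega) (by omega) t) _ _)

/-- One point is at vertex `a` and another one at vertex `c` of the `f`-th strand, `a` lying after
that strand. The point at `c` moves back along `ᾱ_{u/v}` to the beginning of the `f`-th strand (this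
is constant if it is there already), and then the point at `a` moves back along `ᾱ_{u/v}` to its
end. -/
noncomputable def slideBackward (a c f : ℕ) (ha' : a < 4 * (F.u + F.v)) (ha : 2 * f + 1 < a)
    (hc : 2 * f ≤ c ∧ c ≤ 2 * f + 1) (hac : F.vertex a ≠ F.vertex c) :
    Path (Conf.pair (F.vertex a) (F.vertex c) hac)
      (Conf.pair (F.vertex (2 * f + 1)) (F.vertex (2 * f)) (F.vertex_ne_succ _).symm) :=
  (Conf.pathPair (Path.refl (F.vertex a)) (F.along (2 * f) c hc.1).symm
    (fun t => (F.along_ne_vertex hc.1 (by omega) (by omega) (by omega) _).symm) hac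
    (fun e => by have := F.vertex_injOn (by omega) (by omega) e; omega)).trans
  (Conf.pathPair (F.along (2 * f + 1) a ha.le).symm (Path.refl (F.vertex (2 * f)))
    (fun t => F.along_ne_vertex ha.le (by omega) (by omega) (by omega) _) _ _)

/-- The path in `Conf²(M)` from the base point of `κ_j, κ_i` to the configuration with `κ_i` on both
copies of `β`, along which `κ_j` slides along `ᾱ_{u/v}` to `κ_i`, avoiding the part around `X⁻`. If
`κ_j` meets the other point at its arrival, it stops there and the other point moves on in the same
direction, along the strand of `κ_i`, to the other copy of `β`. -/
noncomputable def slide (j i : Fin F.u) : Path (F.base j i) (F.both i) :=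
  if h : F.kappa j < F.kappa i then
    (F.slideForward (idx (F.kappa j) (decide (j < i))) (idx (F.kappa i) !(decide (j < i)))
      (F.kappa i) (F.kappa_lt i) (by have := (idx_bounds (F.kappa j) (decide (j < i))).2; omega)
      (idx_bounds _ _) (by
        rw [vertex_idx, vertex_idx]
        exact F.pt_ne_of_height _ _ (height_ne_height_not _))).cast
      (F.pair_vertex_eq _ _ _ _).symm (F.pair_strand_eq _ _).symm
  else if h' : F.kappa i < F.kappa j then
    (F.slideBackward (idx (F.kappa j) (decide (j < i))) (idx (F.kappa i) !(decide (j < i)))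
      (F.kappa i)
      (by have := (idx_bounds (F.kappa j) (decide (j < i))).2; have := F.kappa_lt j; omega)
      (by have := (idx_bounds (F.kappa j) (decide (j < i))).1; omega)
      (idx_bounds _ _) (by
        rw [vertex_idx, vertex_idx]
        exact F.pt_ne_of_height _ _ (height_ne_height_not _))).cast
      (F.pair_vertex_eq _ _ _ _).symm ((Conf.pair_comm _ _ _).trans (F.pair_strand_eq _ _)).symm
  else (Path.refl (F.both i)).cast
    (by rw [base, both, show F.kappa j = F.kappa i by omega, config_self]) rfl

/-- Two points at consecutive vertices move together along `ᾱ_{u/v}`, past `d` vertices. -/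
noncomputable def slideTogetherAux (n : ℕ) : (d : ℕ) →
    Path (Conf.pair (F.vertex n) (F.vertex (n + 1)) (F.vertex_ne_succ n))
      (Conf.pair (F.vertex (n + d)) (F.vertex (n + d + 1)) (F.vertex_ne_succ (n + d)))
  | 0 => Path.refl _
  | d + 1 => (slideTogetherAux n d).trans
      (Conf.pathPair (F.step (n + d)) (F.step (n + d + 1)) (F.step_ne_step_succ (n + d)) _ _)

/-- Two points at the ends of the `k`-th strand move together along `ᾱ_{u/v}` to the ends of the
`l`-th strand, for `k ≤ l`. -/
noncomputable def slideTogether (k l : ℕ) (h : k ≤ l) :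
    Path (F.config k k true) (F.config l l true) :=
  (F.slideTogetherAux (2 * k) (2 * l - 2 * k)).cast (F.pair_strand_eq k (F.vertex_ne_succ _)).symm
    ((F.pair_strand_eq l (F.vertex_ne_succ _)).symm.trans
      (by simp only [show 2 * k + (2 * l - 2 * k) = 2 * l by omega]))

/-- The path in `Conf²(M)` along which the two points `κ_i` on the two copies of `β` slide together
along `ᾱ_{u/v}`, avoiding the part around `X⁻`, until both are at `κ_ω`. -/
noncomputable def slideBoth (i : Fin F.u) : Path (F.both i) (F.both F.kappaOmega) :=
  if h : F.kappa i ≤ F.kappa F.kappaOmega then F.slideTogether _ _ h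
  else (F.slideTogether _ _ (le_of_not_ge h)).symm

/-- The path in `Conf²(M)` along the two copies of `β` from the configuration with `κ_l` on both of
them to the base point of `κ_j, κ_i`. -/
noncomputable def returnTo (l j i : Fin F.u) : Path (F.both l) (F.base j i) :=
  (Conf.pathPair
    (F.horizontal (F.kappa l) (F.kappa j) (height (decide (j < i))) (Or.inl (height_ne_zero _)))
    (F.horizontal (F.kappa l) (F.kappa i) (height !(decide (j < i))) (Or.inl (height_ne_zero _)))
    (fun _ e => height_ne_height_not _ (congrArg (fun z : F.M => (z : ℂ).im) e))
    (F.pt_ne_of_height _ _ (height_ne_height_not _))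
    (F.pt_ne_of_height _ _ (height_ne_height_not _))).cast
    (F.config_self (F.kappa l) (decide (j < i))).symm rfl

/-- The loop `γ̃_{j,i}` in `Conf²(M)`: `κ_j` slides along `ᾱ_{u/v}` to `κ_i`, and then the point on
the copy of `β` carrying `κ_j` returns along it to `κ_j` (the other point being fixed). -/
noncomputable def gammaTilde (j i : Fin F.u) : Path (F.base j i) (F.base j i) :=
  (F.slide j i).trans (F.returnTo i j i)

/-- The loop `γ²_{j,i}` in `Conf²(M)`: first `κ_j` slides along `ᾱ_{u/v}` to `κ_i`, then the two
points `κ_i` slide together along `ᾱ_{u/v}` to `κ_ω`, and then they return to the base point along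
the two copies of `β`. -/
noncomputable def gammaTwo (j i : Fin F.u) : Path (F.base j i) (F.base j i) :=
  ((F.slide j i).trans (F.slideBoth i)).trans (F.returnTo F.kappaOmega j i)

end KnotFraction

/-! ## The homomorphisms and the matrix `Q` -/

/-- The homomorphism `π₁(Conf^n(ℂ)) ≅ Br_n → ℤ`, the abelianization, given by the number of positive
crossings minus the number of negative crossings of a braid. Each half twist of two strands makes
the discriminant of the configuration wind once about `0`; with the convention for viewing loops in
`Conf^n(ℂ)` as braids, a clockwise half twist is a positive crossing. -/
noncomputable def exponentSum (n : ℕ) (c : Conf n ℂ) :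
    FundamentalGroup (Conf n ℂ) c →* Multiplicative ℤ :=
  ((Winding.hom (Conf.disc n c)).comp (FundamentalGroup.map (Conf.disc n) c))⁻¹

namespace KnotFraction

variable (F : KnotFraction)

/-- The inclusion `M → ℂ ∖ {V}` for a puncture `V`. -/
noncomputable def inclPunctured (V : Puncture) : C(F.M, {z : ℂ // z ≠ (F.position V : ℂ)}) :=
  ⟨fun z => ⟨z.1, z.2 V⟩, by fun_prop⟩

/-- The inclusion `M → ℂ`. -/
noncomputable def incl : C(F.M, ℂ) := ⟨Subtype.val, continuous_subtype_val⟩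

/-- The map `ℂ ∖ {V} → Conf²(ℂ)`, `z ↦ {z, V}`. -/
noncomputable def withPoint (V : ℂ) : C({z : ℂ // z ≠ V}, Conf 2 ℂ) where
  toFun z := Conf.pair z.1 V z.2
  continuous_toFun := by
    refine (Conf.mk 2 ℂ).continuous.comp (Continuous.subtype_mk ?_ _)
    refine continuous_pi (fun k => ?_)
    fin_cases k
    · exact continuous_subtype_val
    · exact continuous_const

/-- `Ψ¹_V : π₁(M) → π₁(ℂ ∖ {V}) → π₁(Conf²(ℂ)) ≅ Br₂ → ℤ`. -/
noncomputable def PsiOne (V : Puncture) (x : F.M) : FundamentalGroup F.M x →* Multiplicative ℤ :=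
  (exponentSum 2 _).comp ((FundamentalGroup.map (withPoint (F.position V)) _).comp
    (FundamentalGroup.map (F.inclPunctured V) x))

/-- `Ψ_W = ½ ∑_{V ∈ W} Ψ¹_V` for a set `W` of punctures. -/
noncomputable def Psi (W : Finset Puncture) {x : F.M} (γ : Path x x) : ℤ :=
  (∑ V ∈ W, (F.PsiOne V x (.fromPath (.mk γ))).toAdd) / 2

/-- `Φ : π₁(Conf²(M)) → π₁(Conf²(ℂ)) ≅ Br₂ → ℤ`, which is also denoted `Φ²`. -/
noncomputable def PhiHom (c : Conf 2 F.M) : FundamentalGroup (Conf 2 F.M) c →* Multiplicative ℤ :=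
  (exponentSum 2 _).comp (FundamentalGroup.map (Conf.map 2 F.incl Subtype.val_injective) c)

/-- `Ψ²_V : π₁(Conf²(M)) → π₁(Conf²(ℂ ∖ {V})) → π₁(Conf³(ℂ)) ≅ Br₃ → ℤ`. -/
noncomputable def PsiTwoHom (V : Puncture) (c : Conf 2 F.M) :
    FundamentalGroup (Conf 2 F.M) c →* Multiplicative ℤ :=
  (exponentSum 3 _).comp ((FundamentalGroup.map (Conf.addPoint 2 (F.position V)) _).comp
    (FundamentalGroup.map (Conf.map 2 (F.inclPunctured V)
      (fun _ _ h => Subtype.ext (congrArg (fun z => z.1) h))) c))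

/-- The value of `Φ` on the class of a loop. -/
noncomputable def Phi {c : Conf 2 F.M} (γ : Path c c) : ℤ :=
  (F.PhiHom c (.fromPath (.mk γ))).toAdd

/-- The value of `Ψ²_V` on the class of a loop. -/
noncomputable def PsiTwo (V : Puncture) {c : Conf 2 F.M} (γ : Path c c) : ℤ :=
  (F.PsiTwoHom V c (.fromPath (.mk γ))).toAdd

/-- `Q_{ii} = (Ψ_{X⁻,Y} - 3 Ψ_{X⁺})([γ_i]) + μ₃`, where `γ_i = γ_{i,ω}`. -/
noncomputable def Qdiag (i : Fin F.u) : ℤ :=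
  F.Psi {.Xminus, .Y} (F.gamma i F.kappaOmega) - 3 * F.Psi {.Xplus} (F.gamma i F.kappaOmega) + F.mu3

/-- The matrix `Q`, with `Q_{ij} = Q_{ii} + (Φ - 2 Ψ_{X⁺})([γ_{j,i}])` for `i ≠ j`; here `Φ` is
evaluated on the loop `γ̃_{j,i}` in `Conf²(M)` and `Ψ_{X⁺}` on the loop `γ_{j,i}` in `M`. -/
noncomputable def Q : Matrix (Fin F.u) (Fin F.u) ℤ := fun i j =>
  if i = j then F.Qdiag i
  else F.Qdiag i + (F.Phi (F.gammaTilde j i) - 2 * F.Psi {.Xplus} (F.gamma j i))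

/-- The values of `Ψ¹_V` are even, so that `Ψ_W` takes integer values. -/
theorem even_PsiOne (V : Puncture) {x : F.M} (γ : Path x x) :
    Even (F.PsiOne V x (.fromPath (.mk γ))).toAdd := by
  let f : C(F.M, PuncturedPlane) := ⟨fun z => ⟨z.1 - F.position V, sub_ne_zero.mpr (z.2 V)⟩, by fun_prop⟩
  let g : C(F.M, PuncturedPlane) := (Conf.disc 2).comp ((withPoint (F.position V)).comp (F.inclPunctured V))
  have hg : ∀ z, (g z : ℂ) = - (f z : ℂ) ^ 2 := by
    intro z
    change (∏ k : Fin 2, ∏ l : Fin 2, if k = l then (1 : ℂ)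
      else ![z.1, (F.position V : ℂ)] k - ![z.1, (F.position V : ℂ)] l) = - (z.1 - F.position V) ^ 2
    simp [Fin.prod_univ_two]
    ring
  have key : Winding.ofLoop (γ.map g.continuous) = 2 * Winding.ofLoop (γ.map f.continuous) := by
    rw [Winding.ofLoop_eq_iff, Winding.logIncrement_eq _
      (Winding.logLift (γ.map f.continuous) + Winding.logLift (γ.map f.continuous) +
        ContinuousMap.const _ (Real.pi * Complex.I))
      (fun t => ?_)]
    · have := Winding.logIncrement_eq_ofLoop (γ.map f.continuous)
      rw [Winding.logIncrement] at this
      simp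
      linear_combination 2 * this
    · have h2 := Winding.exp_logLift (γ.map f.continuous) t
      simp only [ContinuousMap.add_apply, ContinuousMap.const_apply, Complex.exp_add,
        Complex.exp_pi_mul_I, h2]
      change (f (γ t) : ℂ) * (f (γ t) : ℂ) * -1 = (g (γ t) : ℂ)
      rw [hg]
      ring
  have : (F.PsiOne V x (.fromPath (.mk γ))).toAdd = - Winding.ofLoop (γ.map g.continuous) := rfl
  rw [this, key]
  simp

end KnotFraction

/-! ## The total change of the argument -/

/-! Every homomorphism in the statement is `-1/(2π)` times the change of argument of a discriminant
along a loop, the sign expressing that clockwise half twists are positive. Changes of argument add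
under concatenation, so each loop may be cut into pieces. The discriminant of two points and a
puncture `V` is a product of squared differences. Hence `Φ` sees only the difference of the two
points, while `Ψ²_V - Φ` sees only how each point winds about `V`.

Winding about `V`: along the curve, the argument seen from `V` changes by `π` times the change of an
integer `h_V(k) = halfTurns V k`, up to terms at the end points. Moving along `β` or its copies
yields only end terms, and all end terms cancel in the loops. Thus `Ψ¹_V(γ_{j,i}) = h_V(κ_j) -
h_V(κ_i)`, and half the phase of `Ψ²_V - Φ` on `γ²_{j,i}` is `π(2h_V(κ_ω) - h_V(κ_j) - h_V(κ_i))`,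
which is symmetric in `j` and `i`.

The difference of the two points: cut open near `X⁻`, the curve is an embedded arc, so the
difference of two of its points does not vanish on the simply connected set of ordered pairs `s <
t`. Its argument is therefore a function `pairArg` of the pair, and a slide changes it by the
difference of its end values, whatever the order of the moves. On the two ends of strand `k` its
value is `T(k) = togetherTurn (2 * k)`. With `b = baseArg j i` and `r = returnTurn j i`, both
symmetric in `j` and `i`, half the phase is `T(κ_i) - b + r` for `γ̃_{j,i}` and `T(κ_ω) - b + r` for
`γ²_{j,i}`. This gives the symmetry of `Q` once the formula is known.

The formula rests on `two_mul_togetherTurn`: between two crossings of `β`, `2T` changes by `π` times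
the change of the sum of the three `h_V`. So `Ψ_{X⁻,Y} + Ψ_{X⁺}` on `γ_i` equals `-(T(κ_ω) -
T(κ_i))/π`, and since `-3 = 1 - 4` there remains `-4Ψ_{X⁺}`, which is `2(h(κ_ω) - h(κ_i))` for `h =
h_{X⁺}`. This is the diagonal case. For `i ≠ j`, adding `Φ(γ̃_{j,i})` replaces `T(κ_i)` by `b - r`,
and subtracting `2Ψ_{X⁺}(γ_{j,i})` replaces one `h(κ_i)` by `h(κ_j)`. -/

namespace Winding

open unitInterval Complex

open Classical in
/-- The total change of the argument of a nowhere vanishing continuous function on `[0, 1]`. -/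
noncomputable def turn (f : I → ℂ) : ℝ :=
  if h : ∃ L : C(I, ℂ), ∀ t, exp (L t) = f t then (h.choose 1 - h.choose 0).im else 0

/-- Two continuous logarithms of the same function differ by a constant, so the choice in the
definition does not matter. -/
theorem turn_eq {f : I → ℂ} (L : C(I, ℂ)) (hL : ∀ t, exp (L t) = f t) :
    turn f = (L 1 - L 0).im := by
  have h : ∃ L : C(I, ℂ), ∀ t, exp (L t) = f t := ⟨L, hL⟩
  let γ : Path (⟨exp (L 0), exp_ne_zero _⟩ : PuncturedPlane) ⟨exp (L 1), exp_ne_zero _⟩ :=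
    { toFun := fun t => ⟨exp (L t), exp_ne_zero _⟩
      continuous_toFun := by fun_prop
      source' := rfl
      target' := rfl }
  have h1 := logIncrement_eq γ L (fun _ => rfl)
  have h2 := logIncrement_eq γ h.choose
    (fun t => (h.choose_spec t).trans (hL t).symm)
  rw [turn, dif_pos h, ← h2, h1]

theorem im_logIncrement {a b : PuncturedPlane} (γ : Path a b) :
    (logIncrement γ).im = turn fun t => (γ t : ℂ) :=
  (turn_eq (logLift γ) (exp_logLift γ)).symm

theorem exists_log {f : I → ℂ} (hf : Continuous f) (h0 : ∀ t, f t ≠ 0) :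
    ∃ L : C(I, ℂ), ∀ t, exp (L t) = f t :=
  let γ : Path (⟨f 0, h0 0⟩ : PuncturedPlane) ⟨f 1, h0 1⟩ :=
    { toFun := fun t => ⟨f t, h0 t⟩
      continuous_toFun := by fun_prop
      source' := rfl
      target' := rfl }
  ⟨logLift γ, exp_logLift γ⟩

theorem turn_const (c : ℂ) (hc : c ≠ 0) : turn (fun _ => c) = 0 := by
  rw [turn_eq (ContinuousMap.const I (log c)) (fun _ => exp_log hc)]
  simp

theorem turn_mul {f g : I → ℂ} (hf : Continuous f) (hg : Continuous g) (f0 : ∀ t, f t ≠ 0)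
    (g0 : ∀ t, g t ≠ 0) : turn (fun t => f t * g t) = turn f + turn g := by
  obtain ⟨L, hL⟩ := exists_log hf f0
  obtain ⟨K, hK⟩ := exists_log hg g0
  rw [turn_eq (L + K) (fun t => by simp [exp_add, hL, hK]), turn_eq L hL, turn_eq K hK]
  simp
  ring

theorem turn_const_mul {f : I → ℂ} (hf : Continuous f) (f0 : ∀ t, f t ≠ 0) {c : ℂ} (hc : c ≠ 0) :
    turn (fun t => c * f t) = turn f := by
  rw [turn_mul continuous_const hf (fun _ => hc) f0, turn_const c hc, zero_add]

theorem turn_neg {f : I → ℂ} (hf : Continuous f) (f0 : ∀ t, f t ≠ 0) :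
    turn (fun t => - f t) = turn f := by
  simpa using turn_const_mul hf f0 (c := -1) (by simp)

theorem turn_symm {f : I → ℂ} (hf : Continuous f) (f0 : ∀ t, f t ≠ 0) :
    turn (fun t => f (σ t)) = - turn f := by
  obtain ⟨L, hL⟩ := exists_log hf f0
  rw [turn_eq (L.comp ⟨σ, continuous_symm⟩) (fun t => by simp [hL]), turn_eq L hL]
  simp

/-- The principal logarithm is continuous on the slit plane and serves as the logarithm along the
path. -/
theorem turn_of_mem_slitPlane {f : I → ℂ} (hf : Continuous f) (h : ∀ t, f t ∈ slitPlane) :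
    turn f = arg (f 1) - arg (f 0) := by
  have hc : Continuous fun t => log (f t) :=
    continuous_iff_continuousAt.mpr fun t => (hf.continuousAt).clog (h t)
  rw [turn_eq ⟨fun t => log (f t), hc⟩ (fun t => exp_log (slitPlane_ne_zero (h t)))]
  simp [log_im]

theorem turn_trans {X : Type*} [TopologicalSpace X] {a b c : X} {g : X → ℂ} (hg : Continuous g)
    (γ : Path a b) (δ : Path b c) (h1 : ∀ t, g (γ t) ≠ 0) (h2 : ∀ t, g (δ t) ≠ 0) :
    turn (fun t => g (γ.trans δ t)) = turn (fun t => g (γ t)) + turn (fun t => g (δ t)) := by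
  have ha : g a ≠ 0 := by simpa using h1 0
  have hb : g b ≠ 0 := by simpa using h1 1
  have hc : g c ≠ 0 := by simpa using h2 1
  let γ' : Path (⟨g a, ha⟩ : PuncturedPlane) ⟨g b, hb⟩ :=
    { toFun := fun t => ⟨g (γ t), h1 t⟩
      continuous_toFun := by fun_prop
      source' := by simp
      target' := by simp }
  let δ' : Path (⟨g b, hb⟩ : PuncturedPlane) ⟨g c, hc⟩ :=
    { toFun := fun t => ⟨g (δ t), h2 t⟩
      continuous_toFun := by fun_prop
      source' := by simp
      target' := by simp }
  have h := congrArg Complex.im (logIncrement_trans γ' δ')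
  rw [add_im, im_logIncrement, im_logIncrement, im_logIncrement] at h
  refine Eq.trans (congrArg turn (funext fun t => ?_)) h
  rw [Path.trans_apply, Path.trans_apply]
  split_ifs <;> rfl

/-- The two ways around the boundary of the square are homotopic, and a nonvanishing function on the
square carries the homotopy into the punctured plane. -/
theorem turn_square {F : ℝ × ℝ → ℂ} (hF : Continuous F)
    (h0 : ∀ s t : I, F (s, t) ≠ 0) :
    turn (fun t => F (t, 0)) + turn (fun t => F (1, t)) =
      turn (fun t => F (0, t)) + turn (fun t => F (t, 1)) := by
  -- Clamping both coordinates to `[0, 1]` extends the nonvanishing function from the square to the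
  -- whole plane, where any two paths with the same ends are homotopic.
  let G : ℝ × ℝ → PuncturedPlane := fun p =>
    ⟨F (Set.projIcc 0 1 zero_le_one p.1, Set.projIcc 0 1 zero_le_one p.2), h0 _ _⟩
  have hG : Continuous G := by
    refine Continuous.subtype_mk (hF.comp ?_) _
    exact ((continuous_subtype_val.comp continuous_projIcc).comp continuous_fst).prodMk
      ((continuous_subtype_val.comp continuous_projIcc).comp continuous_snd)
  let p : Path ((0, 0) : ℝ × ℝ) (1, 0) := ⟨⟨fun t => (t, 0), by fun_prop⟩, by simp, by simp⟩
  let q : Path ((1, 0) : ℝ × ℝ) (1, 1) := ⟨⟨fun t => (1, t), by fun_prop⟩, by simp, by simp⟩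
  let p' : Path ((0, 0) : ℝ × ℝ) (0, 1) := ⟨⟨fun t => (0, t), by fun_prop⟩, by simp, by simp⟩
  let q' : Path ((0, 1) : ℝ × ℝ) (1, 1) := ⟨⟨fun t => (t, 1), by fun_prop⟩, by simp, by simp⟩
  have hom : (p.trans q).Homotopic (p'.trans q') := SimplyConnectedSpace.paths_homotopic _ _
  have key := congrArg Complex.im (logIncrement_homotopic (hom.map ⟨G, hG⟩))
  have e : ∀ (x y : ℝ × ℝ) (r : Path x y), (logIncrement (r.map hG)).im =
      turn (fun t => F (Set.projIcc 0 1 zero_le_one (r t).1, Set.projIcc 0 1 zero_le_one (r t).2)) :=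
    fun x y r => im_logIncrement _
  have key' : (logIncrement ((p.trans q).map hG)).im = (logIncrement ((p'.trans q').map hG)).im :=
    key
  rw [Path.map_trans, Path.map_trans, logIncrement_trans, logIncrement_trans, add_im, add_im,
    e, e, e, e] at key'
  simpa [p, q, p', q'] using key'

/-- The map `(s, t) ↦ (st, t)` sends the square onto the triangle `s ≤ t`. It collapses the edge `t
= 0` to the corner `(0, 0)`, where nothing turns, and sends the edge `s = 1` to the diagonal. -/
theorem turn_triangle {F : ℝ × ℝ → ℂ} (hF : Continuous F)
    (h0 : ∀ s t : I, s ≤ t → F (s, t) ≠ 0) :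
    turn (fun t => F (t, t)) = turn (fun t => F (0, t)) + turn (fun t => F (t, 1)) := by
  have h := turn_square (F := fun p => F (p.1 * p.2, p.2)) (by fun_prop)
    (fun s t => h0 (s * t) t (Subtype.coe_le_coe.mp (by
      simpa using mul_le_of_le_one_left t.2.1 s.2.2)))
  have h00 : F (0, 0) ≠ 0 := h0 0 0 le_rfl
  simpa [turn_const _ h00] using h

end Winding

/-! ## Disjointness of the pieces of the curve -/

namespace KnotFraction

open unitInterval

variable (F : KnotFraction)

theorem continuous_stepFun (n : ℕ) : Continuous (F.stepFun n) := by
  have : ∀ x y : ℝ, (⟨x, y⟩ : ℂ) = x + y * Complex.I := Complex.mk_eq_add_mul_I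
  unfold stepFun
  simp only [this]
  split_ifs <;> fun_prop

theorem stepFun_zero (n : ℕ) : F.stepFun n 0 = F.vertex n := by
  have h := congrArg Subtype.val (F.step n).source
  rwa [coe_step] at h

theorem stepFun_one (n : ℕ) : F.stepFun n 1 = F.vertex (n + 1) := by
  have h := congrArg Subtype.val (F.step n).target
  rwa [coe_step] at h

theorem half_succ {n : ℕ} (h : ¬ Even n) : (n + 1) / 2 = n / 2 + 1 := by
  rw [Nat.even_iff] at h
  omega

theorem half_succ_of_even {n : ℕ} (h : Even n) : (n + 1) / 2 = n / 2 := by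
  rw [Nat.even_iff] at h
  omega

theorem re_stepFun_of_even {n : ℕ} (h : Even n) (t : ℝ) :
    (F.stepFun n t).re = F.strand (n / 2) := by
  simp [stepFun, half_succ_of_even h]

theorem abs_height (b : Bool) : |height b| = 1 := by
  cases b <;> simp [height]

theorem abs_im_stepFun_le {n : ℕ} (h : Even n) (t : I) : |(F.stepFun n t).im| ≤ 1 := by
  simp only [stepFun, if_pos h, abs_mul, abs_height, one_mul]
  rw [abs_le]
  constructor <;> linarith [t.2.1, t.2.2]

/-- A semicircle leaves the closed strip between the lines `Im = ±1` at once and touches it only at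
its two ends, whereas the vertical pieces stay inside. -/
theorem eq_zero_or_one_of_abs_im_le {n : ℕ} (h : ¬ Even n) (t : I)
    (ht : |(F.stepFun n t).im| ≤ 1) : t = 0 ∨ t = 1 := by
  by_contra! hne
  have h0 : 0 < (t : ℝ) := lt_of_le_of_ne t.2.1 fun e => hne.1 (Subtype.ext e.symm)
  have h1 : (t : ℝ) < 1 := lt_of_le_of_ne t.2.2 fun e => hne.2 (Subtype.ext e)
  have hs : 0 < Real.sin (Real.pi * t) :=
    Real.sin_pos_of_pos_of_lt_pi (by positivity) (by nlinarith [Real.pi_pos])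
  have hr := F.half_width_pos n h
  simp only [stepFun, if_neg h, abs_mul, abs_height, one_mul] at ht
  have := mul_pos hr hs
  rw [abs_of_pos (by linarith)] at ht
  linarith

/-- Consecutive pieces share only the vertex at `s = 1`, `t = 0`, which `s ≤ t` excludes. One of the
two pieces is vertical and the other a semicircle, so they can meet only at an end of the
semicircle. -/
theorem step_ne_step_succ_of_le (n : ℕ) {s t : I} (hst : s ≤ t) :
    F.step n s ≠ F.step (n + 1) t := by
  intro e
  have e' : F.stepFun n s = F.stepFun (n + 1) t := congrArg Subtype.val e
  by_cases h : Even n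
  · have h' : ¬ Even (n + 1) := by simpa [Nat.even_add_one] using h
    rcases F.eq_zero_or_one_of_abs_im_le h' t (e' ▸ F.abs_im_stepFun_le h s) with rfl | rfl
    · obtain rfl : s = 0 := le_antisymm hst s.2.1
      rw [Path.source, Path.source] at e
      exact F.vertex_ne_succ n e
    · have := congrArg Complex.re e'
      rw [F.re_stepFun_of_even h, Set.Icc.coe_one, stepFun_one] at this
      simp only [vertex, pt] at this
      rw [show (n + 1 + 1) / 2 = n / 2 + 1 by omega] at this
      exact F.strand_ne_succ _ (by exact_mod_cast this)
  · have h' : Even (n + 1) := by simpa [Nat.even_add_one] using h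
    rcases F.eq_zero_or_one_of_abs_im_le h s (e' ▸ F.abs_im_stepFun_le h' t) with rfl | rfl
    · have := congrArg Complex.re e'
      rw [F.re_stepFun_of_even h', Set.Icc.coe_zero, stepFun_zero, half_succ h] at this
      simp only [vertex, pt] at this
      exact F.strand_ne_succ _ (by exact_mod_cast this)
    · obtain rfl : t = 1 := le_antisymm t.2.2 hst
      rw [Path.target, Path.target] at e
      exact F.vertex_ne_succ (n + 1) e

theorem strand_add_succ_of_even {k : ℕ} (h : Even k) :
    F.strand k + F.strand (k + 1) = 4 * F.v := by
  rw [strand, if_pos h]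
  ring

/-- The lower semicircles form two concentric families, and both ends of a semicircle lie on the
same side of position `2u`, so the family can be read off from either end. -/
theorem strand_add_succ_of_odd {k : ℕ} (h : ¬ Even k) :
    (F.strand k + F.strand (k + 1) = 0 ∧ |F.strand k| < 2 * F.u ∧ |F.strand (k + 1)| < 2 * F.u) ∨
    (F.strand k + F.strand (k + 1) = 4 * (F.u + F.v) ∧ 2 * F.u < F.strand k ∧
      2 * F.u < F.strand (k + 1)) := by
  have h1 := F.strand_mem k
  have h2 := F.strand_mem (k + 1)
  obtain ⟨c, hc⟩ := F.strand_odd k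
  have := F.v_pos
  rw [strand, if_neg h] at h2 ⊢
  split_ifs at h2 ⊢ with h3
  · left
    simpa using h3
  · right
    rw [abs_lt] at h3
    omega

theorem re_stepFun_mem {n : ℕ} {a b : ℝ} (t : ℝ)
    (h1 : a < (F.strand (n / 2) : ℝ) ∧ (F.strand (n / 2) : ℝ) < b)
    (h2 : a < (F.strand ((n + 1) / 2) : ℝ) ∧ (F.strand ((n + 1) / 2) : ℝ) < b) :
    a < (F.stepFun n t).re ∧ (F.stepFun n t).re < b := by
  simp only [stepFun]
  have hc := Real.cos_le_one (Real.pi * t)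
  have hc' := Real.neg_one_le_cos (Real.pi * t)
  set x : ℝ := ((F.strand (n / 2) : ℤ) : ℝ)
  set y : ℝ := ((F.strand ((n + 1) / 2) : ℤ) : ℝ)
  set c := Real.cos (Real.pi * t)
  constructor <;> rcases le_total x y with h | h <;> nlinarith

/-- Distinct vertical pieces lie on distinct strands. A vertical piece meets a semicircle at most at
a vertex. Two semicircles in the same half plane are either concentric with different radii or, in
the lower half plane, separated by the line `Re = 2u`. -/
theorem step_ne_step {n m : ℕ} (hnm : n + 1 < m) (hm : m + 1 < 4 * (F.u + F.v)) (s t : I) :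
    F.step n s ≠ F.step m t := by
  intro e
  have e' : F.stepFun n s = F.stepFun m t := congrArg Subtype.val e
  by_cases h : Even n <;> by_cases h' : Even m
  · have := congrArg Complex.re e'
    rw [F.re_stepFun_of_even h, F.re_stepFun_of_even h'] at this
    have := F.strand_injOn (k := n / 2) (l := m / 2) (by omega) (by omega) (by exact_mod_cast this)
    rw [Nat.even_iff] at h h'
    omega
  · rcases F.eq_zero_or_one_of_abs_im_le h' t (e' ▸ F.abs_im_stepFun_le h s) with rfl | rfl
    · rw [Path.source] at e
      exact F.step_ne_vertex (by omega) (by omega) (by omega) (by omega) s e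
    · rw [Path.target] at e
      exact F.step_ne_vertex (by omega) (by omega) (by omega) (by omega) s e
  · rcases F.eq_zero_or_one_of_abs_im_le h s (e' ▸ F.abs_im_stepFun_le h' t) with rfl | rfl
    · rw [Path.source] at e
      exact F.step_ne_vertex (by omega) (by omega) (by omega) (by omega) t e.symm
    · rw [Path.target] at e
      exact F.step_ne_vertex (by omega) (by omega) (by omega) (by omega) t e.symm
  · have hre := congrArg Complex.re e'
    have him := congrArg Complex.im e'
    have hs := sin_nonneg_of_unit s.2.1 s.2.2
    have ht := sin_nonneg_of_unit t.2.1 t.2.2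
    have hr := F.half_width_pos n h
    have hr' := F.half_width_pos m h'
    have hne : ∀ k l : ℕ, k ≤ n / 2 → m / 2 ≤ l → l ≤ (m + 1) / 2 →
        (F.strand k : ℝ) ≠ F.strand l := by
      intro k l hk hl hl' e
      have := F.strand_injOn (k := k) (l := l) (by omega) (by omega) (by exact_mod_cast e)
      rw [Nat.even_iff] at h h'
      omega
    -- Concentric semicircles through a common point have equal radii, hence a common end, which
    -- contradicts that distinct strands have distinct positions.
    have hsame : (F.strand (n / 2) : ℝ) + F.strand ((n + 1) / 2) ≠
        F.strand (m / 2) + F.strand ((m + 1) / 2) ∨ onTop n ≠ onTop m := by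
      by_contra! hc
      obtain ⟨hc, htop⟩ := hc
      simp only [stepFun, if_neg h, if_neg h', hc, htop] at hre him
      have him' := mul_left_cancel₀ (height_ne_zero (onTop m)) him
      set x : ℝ := ((F.strand (n / 2) : ℤ) : ℝ)
      set y : ℝ := ((F.strand ((n + 1) / 2) : ℤ) : ℝ)
      set z : ℝ := ((F.strand (m / 2) : ℤ) : ℝ)
      set w : ℝ := ((F.strand ((m + 1) / 2) : ℤ) : ℝ)
      have e1 : (x - y) * Real.cos (Real.pi * s) = (z - w) * Real.cos (Real.pi * t) := by linarith
      have e2 : |x - y| * Real.sin (Real.pi * s) = |z - w| * Real.sin (Real.pi * t) := by linarith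
      have e3 : (x - y) ^ 2 = (z - w) ^ 2 := by
        have a1 := congrArg (· ^ 2) e1
        have a2 := congrArg (· ^ 2) e2
        simp only [mul_pow, sq_abs] at a1 a2
        linear_combination a1 + a2 - (x - y) ^ 2 * Real.sin_sq_add_cos_sq (Real.pi * s)
          + (z - w) ^ 2 * Real.sin_sq_add_cos_sq (Real.pi * t)
      rcases sq_eq_sq_iff_eq_or_eq_neg.mp e3 with e4 | e4
      · exact hne (n / 2) (m / 2) (by omega) le_rfl (by omega) (by linarith)
      · exact hne (n / 2) ((m + 1) / 2) (by omega) (by omega) le_rfl (by linarith)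
    have htop : onTop n = onTop m := by
      have a1 : 0 < 1 + |(F.strand (n / 2) : ℝ) - F.strand ((n + 1) / 2)| / 2 *
          Real.sin (Real.pi * s) := by positivity
      have a2 : 0 < 1 + |(F.strand (m / 2) : ℝ) - F.strand ((m + 1) / 2)| / 2 *
          Real.sin (Real.pi * t) := by positivity
      simp only [stepFun, if_neg h, if_neg h'] at him
      rcases hb : onTop n <;> rcases hb' : onTop m <;> simp [hb, hb', height] at him ⊢ <;> linarith
    rw [half_succ h, half_succ h'] at hsame
    have hsum := hsame.resolve_right (not_not_intro htop)
    -- Lying in the same half plane means that the starting strands have the same parity. All upper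
    -- semicircles are concentric, so only odd strands leave two possible centres.
    have hpar : Even (n / 2) ↔ Even (m / 2) := by
      simp only [onTop, decide_eq_decide] at htop
      simp only [Nat.even_iff] at h h' ⊢
      omega
    by_cases hk : Even (n / 2)
    · apply hsum
      have a1 := F.strand_add_succ_of_even hk
      have a2 := F.strand_add_succ_of_even (hpar.mp hk)
      exact_mod_cast a1.trans a2.symm
    · have b1 := F.strand_mem (n / 2)
      have b2 := F.strand_mem (n / 2 + 1)
      have b3 := F.strand_mem (m / 2)
      have b4 := F.strand_mem (m / 2 + 1)
      have big : ∀ q : ℕ, ¬ Even q → 2 * F.u < F.strand (q / 2) →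
          2 * F.u < F.strand (q / 2 + 1) → ∀ r : ℝ, (2 * F.u : ℝ) < (F.stepFun q r).re := by
        intro q hq g1 g2 r
        have g3 := F.strand_mem (q / 2)
        have g4 := F.strand_mem (q / 2 + 1)
        refine (F.re_stepFun_mem (n := q) (b := 2 * F.u + 4 * F.v) r ?_ ?_).1
        · exact_mod_cast And.intro g1 g3.2
        · rw [half_succ hq]
          exact_mod_cast And.intro g2 g4.2
      have small : ∀ q : ℕ, ¬ Even q → |F.strand (q / 2)| < 2 * F.u →
          |F.strand (q / 2 + 1)| < 2 * F.u → ∀ r : ℝ, (F.stepFun q r).re < (2 * F.u : ℝ) := by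
        intro q hq g1 g2 r
        rw [abs_lt] at g1 g2
        refine (F.re_stepFun_mem (n := q) (a := -(2 * F.u)) r ?_ ?_).2
        · exact_mod_cast g1
        · rw [half_succ hq]
          exact_mod_cast g2
      rcases F.strand_add_succ_of_odd hk with ⟨a1, a2, a3⟩ | ⟨a1, a2, a3⟩ <;>
        rcases F.strand_add_succ_of_odd (fun hm => hk (hpar.mpr hm)) with ⟨c1, c2, c3⟩ | ⟨c1, c2, c3⟩
      · exact hsum (by exact_mod_cast a1.trans c1.symm)
      · linarith [small n h a2 a3 s, big m h' c2 c3 t]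
      · linarith [small m h' c2 c3 t, big n h a2 a3 s]
      · exact hsum (by exact_mod_cast a1.trans c1.symm)

end KnotFraction

/-! ## The argument of the difference of two points on the curve -/

namespace KnotFraction

open unitInterval Winding

variable (F : KnotFraction)

/-- The change of the argument of the difference of a point moving along the `m`-th piece of the
curve and the `n`-th vertex. -/
noncomputable def stepTurn (m n : ℕ) : ℝ :=
  turn fun t => F.stepFun m t - F.vertex n

/-- The change of the argument of the difference of two points moving along the `n`-th and the next
piece of the curve. -/
noncomputable def diagTurn (n : ℕ) : ℝ :=
  turn fun t => F.stepFun (n + 1) t - F.stepFun n t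

/-- The change of the argument of the difference of two points at consecutive vertices which move
together along the curve from the vertices `0` and `1` to the vertices `n` and `n + 1`. -/
noncomputable def togetherTurn (n : ℕ) : ℝ := ∑ i ∈ Finset.range n, F.diagTurn i

/-- The argument, up to a constant, of the difference of the `m`-th and the `n`-th vertex, for
`n < m`, as a continuous function on pairs of points of the curve. -/
noncomputable def pairArg (n m : ℕ) : ℝ :=
  F.togetherTurn n + ∑ i ∈ Finset.Ico (n + 1) m, F.stepTurn i n

@[fun_prop]
theorem continuous_stepFun_comp {X : Type*} [TopologicalSpace X] (n : ℕ) {f : X → ℝ}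
    (hf : Continuous f) : Continuous fun x => F.stepFun n (f x) :=
  (F.continuous_stepFun n).comp hf

theorem stepFun_sub_vertex_ne {n c : ℕ} (hn : n + 1 < 4 * (F.u + F.v)) (hc : c < 4 * (F.u + F.v))
    (h1 : c ≠ n) (h2 : c ≠ n + 1) (t : I) : F.stepFun n t - F.vertex c ≠ 0 :=
  fun e => F.step_ne_vertex hn hc h1 h2 t (Subtype.ext (sub_eq_zero.mp e))

/-- The difference of a point on piece `n` and a point on piece `m` is nonzero on a whole square, so
moving one point and then the other turns it equally in either order. -/
theorem stepTurn_add_stepTurn {n m : ℕ} (hnm : n + 1 < m) (hm : m + 1 < 4 * (F.u + F.v)) :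
    F.stepTurn n m + F.stepTurn m (n + 1) = F.stepTurn m n + F.stepTurn n (m + 1) := by
  have h := turn_square (F := fun p => F.stepFun n p.1 - F.stepFun m p.2)
    (by fun_prop) (fun s t e =>
      F.step_ne_step hnm hm s t (Subtype.ext (sub_eq_zero.mp e)))
  simp only [stepFun_zero, stepFun_one] at h
  have e : ∀ c : ℕ, c = n ∨ c = n + 1 →
      turn (fun t : I => (F.vertex c : ℂ) - F.stepFun m t) = F.stepTurn m c := by
    intro c hc
    rw [stepTurn, ← turn_neg (by fun_prop)
      (F.stepFun_sub_vertex_ne (by omega) (by omega) (by omega) (by omega))]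
    simp only [neg_sub]
  rwa [e n (Or.inl rfl), e (n + 1) (Or.inr rfl)] at h

/-- Moving both points at once turns their difference as much as moving the front point first and
the rear point afterwards. The intermediate pairs fill the triangle `s ≤ t`, on which consecutive
pieces do not meet. -/
theorem diagTurn_eq {n : ℕ} (hn : n + 2 < 4 * (F.u + F.v)) :
    F.diagTurn n = F.stepTurn (n + 1) n + F.stepTurn n (n + 2) := by
  have h := turn_triangle (F := fun p => F.stepFun (n + 1) p.2 - F.stepFun n p.1)
    (by fun_prop) (fun s t hst e =>
      F.step_ne_step_succ_of_le n hst (Subtype.ext (sub_eq_zero.mp e).symm))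
  simp only [stepFun_zero, stepFun_one] at h
  rw [diagTurn, h, stepTurn, stepTurn, ← turn_neg (f := fun t : I => F.stepFun n t - _)
    (by fun_prop) (F.stepFun_sub_vertex_ne (by omega) (by omega) (by omega) (by omega))]
  simp only [neg_sub]

theorem pairArg_succ_self (n : ℕ) : F.pairArg n (n + 1) = F.togetherTurn n := by
  simp [pairArg]

theorem pairArg_succ_right {n m : ℕ} (h : n < m) :
    F.pairArg n (m + 1) = F.pairArg n m + F.stepTurn m n := by
  rw [pairArg, pairArg, Finset.sum_Ico_succ_top (by omega)]
  ring

/-- This is path independence. `pairArg` is defined by moving together and then advancing the front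
point; here advancing the rear point is seen to change it correctly as well. The induction on `m`
starts with the triangle relation and continues with the square relation. -/
theorem pairArg_succ_left {n m : ℕ} (h : n + 1 < m) (hm : m < 4 * (F.u + F.v)) :
    F.pairArg (n + 1) m = F.pairArg n m + F.stepTurn n m := by
  induction m, h using Nat.le_induction with
  | base =>
    rw [pairArg_succ_self, F.pairArg_succ_right (by omega), pairArg_succ_self, togetherTurn,
      Finset.sum_range_succ, F.diagTurn_eq (by omega), togetherTurn]
    ring
  | succ m h ih =>
    rw [F.pairArg_succ_right (by omega), F.pairArg_succ_right (by omega), ih (by omega)]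
    linarith [F.stepTurn_add_stepTurn (n := n) (m := m) (by omega) (by omega)]

theorem alongAux_sub_ne {n c : ℕ} (hc : c < 4 * (F.u + F.v)) (d : ℕ)
    (hd : n + d < 4 * (F.u + F.v)) (h : c < n ∨ n + d < c) (t : I) :
    (F.alongAux n d t : ℂ) - F.vertex c ≠ 0 :=
  fun e => F.alongAux_ne_vertex hc d hd h t (Subtype.ext (sub_eq_zero.mp e))

theorem turn_alongAux_succ {n d : ℕ} {c : ℂ} (h1 : ∀ t, (F.alongAux n d t : ℂ) - c ≠ 0)
    (h2 : ∀ t : I, F.stepFun (n + d) t - c ≠ 0) :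
    turn (fun t => (F.alongAux n (d + 1) t : ℂ) - c) =
      turn (fun t => (F.alongAux n d t : ℂ) - c) + turn (fun t : I => F.stepFun (n + d) t - c) :=
  turn_trans (g := fun z : F.M => (z : ℂ) - c) (by fun_prop) _ _ h1 h2

theorem turn_along_sub_of_lt {c n m : ℕ} (hnm : n ≤ m) (hc : c < n) (hm : m < 4 * (F.u + F.v)) :
    turn (fun t => (F.along n m hnm t : ℂ) - F.vertex c) = F.pairArg c m - F.pairArg c n := by
  obtain ⟨d, rfl⟩ := Nat.exists_eq_add_of_le hnm
  -- The path `along` is `alongAux` up to a cast of its end point, which does not affect its values.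
  change turn (fun t => (F.alongAux n (n + d - n) t : ℂ) - F.vertex c) = _
  rw [Nat.add_sub_cancel_left]
  clear hnm
  induction d with
  | zero =>
    have h := F.alongAux_sub_ne (n := n) (c := c) (by omega) 0 hm (Or.inl hc) 0
    simp only [alongAux, Path.refl_apply] at h ⊢
    rw [turn_const _ h]
    simp
  | succ d ih =>
    rw [F.turn_alongAux_succ (F.alongAux_sub_ne (by omega) d (by omega) (by omega))
      (F.stepFun_sub_vertex_ne (by omega) (by omega) (by omega) (by omega)), ih (by omega),
      ← Nat.add_assoc n d 1, F.pairArg_succ_right (by omega), stepTurn]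
    ring

theorem turn_along_sub_of_gt {c n m : ℕ} (hnm : n ≤ m) (hm : m < c) (hc : c < 4 * (F.u + F.v)) :
    turn (fun t => (F.along n m hnm t : ℂ) - F.vertex c) = F.pairArg m c - F.pairArg n c := by
  obtain ⟨d, rfl⟩ := Nat.exists_eq_add_of_le hnm
  change turn (fun t => (F.alongAux n (n + d - n) t : ℂ) - F.vertex c) = _
  rw [Nat.add_sub_cancel_left]
  clear hnm
  induction d with
  | zero =>
    have h := F.alongAux_sub_ne (n := n) (c := c) (by omega) 0 (by omega) (Or.inr hm) 0
    simp only [alongAux, Path.refl_apply] at h ⊢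
    rw [turn_const _ h]
    simp
  | succ d ih =>
    rw [F.turn_alongAux_succ (F.alongAux_sub_ne (by omega) d (by omega) (by omega))
      (F.stepFun_sub_vertex_ne (by omega) (by omega) (by omega) (by omega)), ih (by omega),
      ← Nat.add_assoc n d 1, F.pairArg_succ_left (by omega) (by omega), stepTurn]
    ring

end KnotFraction

/-! ## The change of the argument of a function along a path -/

namespace Winding

open unitInterval

variable {X : Type} [TopologicalSpace X] (f : C(X, PuncturedPlane))

/-- The change of the argument of `f` along a path. -/
noncomputable def phase {a b : X} (γ : Path a b) : ℝ := turn fun t => (f (γ t) : ℂ)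

theorem phase_trans {a b c : X} (γ : Path a b) (δ : Path b c) :
    phase f (γ.trans δ) = phase f γ + phase f δ :=
  turn_trans (g := fun x => (f x : ℂ)) (by fun_prop) γ δ (fun t => (f (γ t)).2)
    (fun t => (f (δ t)).2)

theorem phase_symm {a b : X} (γ : Path a b) : phase f γ.symm = - phase f γ :=
  turn_symm (f := fun t => (f (γ t) : ℂ)) (by fun_prop) (fun t => (f (γ t)).2)

theorem phase_refl (a : X) : phase f (Path.refl a) = 0 :=
  turn_const _ (f a).2

theorem phase_cast {a b a' b' : X} (γ : Path a b) (ha : a' = a) (hb : b' = b) :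
    phase f (γ.cast ha hb) = phase f γ := rfl

theorem two_pi_mul_ofLoop {a : X} (γ : Path a a) :
    2 * Real.pi * ofLoop (γ.map f.continuous) = phase f γ := by
  have h := congrArg Complex.im (logIncrement_eq_ofLoop (γ.map f.continuous))
  rw [im_logIncrement] at h
  have e : phase f γ = turn fun t => ((γ.map f.continuous) t : ℂ) := rfl
  rw [e, h]
  simp
  ring

end Winding

/-! ### Discriminants of pairs and triples, and the homomorphisms as phases -/

namespace KnotFraction

open unitInterval Winding

variable (F : KnotFraction)

/-- The negative of the squared difference of two points of `M`. -/
noncomputable def pairDisc : C(Conf 2 F.M, PuncturedPlane) :=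
  (Conf.disc 2).comp (Conf.map 2 F.incl Subtype.val_injective)

/-- The negative of the discriminant of the configuration consisting of two points of `M` and a
puncture. -/
noncomputable def tripleDisc (V : Puncture) : C(Conf 2 F.M, PuncturedPlane) :=
  (Conf.disc 3).comp ((Conf.addPoint 2 (F.position V)).comp (Conf.map 2 (F.inclPunctured V)
    (fun _ _ h => Subtype.ext (congrArg (fun z => z.1) h))))

/-- The negative of the squared difference of a point of `M` and a puncture. -/
noncomputable def pointDisc (V : Puncture) : C(F.M, PuncturedPlane) :=
  (Conf.disc 2).comp ((withPoint (F.position V)).comp (F.inclPunctured V))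

theorem coe_pairDisc (a b : F.M) (h : a ≠ b) :
    (F.pairDisc (Conf.pair a b h) : ℂ) = - (((a : ℂ) - b) * ((a : ℂ) - b)) := by
  change (∏ k : Fin 2, ∏ l : Fin 2, if k = l then (1 : ℂ)
    else ((![a, b] k : F.M) : ℂ) - (![a, b] l : F.M)) = _
  simp [Fin.prod_univ_two]
  ring

theorem coe_pointDisc (V : Puncture) (a : F.M) :
    (F.pointDisc V a : ℂ) = - (((a : ℂ) - F.position V) * ((a : ℂ) - F.position V)) := by
  change (∏ k : Fin 2, ∏ l : Fin 2, if k = l then (1 : ℂ)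
    else ![(a : ℂ), (F.position V : ℂ)] k - ![(a : ℂ), (F.position V : ℂ)] l) = _
  simp [Fin.prod_univ_two]
  ring

theorem coe_tripleDisc (V : Puncture) (a b : F.M) (h : a ≠ b) :
    (F.tripleDisc V (Conf.pair a b h) : ℂ) = F.pairDisc (Conf.pair a b h) *
      (((a : ℂ) - F.position V) * ((a : ℂ) - F.position V) *
      (((b : ℂ) - F.position V) * ((b : ℂ) - F.position V))) := by
  rw [coe_pairDisc]
  have e : (F.tripleDisc V (Conf.pair a b h) : ℂ) = ∏ k : Fin 3, ∏ l : Fin 3, if k = l then (1 : ℂ)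
    else (Fin.cons (F.position V : ℂ) (fun k => ((![a, b] k : F.M) : ℂ)) : Fin 3 → ℂ) k -
      (Fin.cons (F.position V : ℂ) (fun k => ((![a, b] k : F.M) : ℂ)) : Fin 3 → ℂ) l := rfl
  rw [e]
  simp [Fin.prod_univ_three, Fin.cons, Fin.cases, Fin.induction, Fin.induction.go]
  ring

theorem sub_position_ne (V : Puncture) (z : F.M) : (z : ℂ) - F.position V ≠ 0 :=
  sub_ne_zero.mpr (z.2 V)

theorem phase_pointDisc (V : Puncture) {a b : F.M} (p : Path a b) :
    phase (F.pointDisc V) p = 2 * turn fun t => (p t : ℂ) - F.position V := by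
  have hc : Continuous fun t => (p t : ℂ) - F.position V := by fun_prop
  have h0 : ∀ t, (p t : ℂ) - F.position V ≠ 0 := fun t => F.sub_position_ne V _
  simp only [phase, coe_pointDisc]
  rw [turn_neg (by fun_prop) (fun t => mul_ne_zero (h0 t) (h0 t)), turn_mul hc hc h0 h0]
  ring

theorem phase_pairDisc {a b c d : F.M} (p : Path a b) (q : Path c d) (h : ∀ t, p t ≠ q t)
    (h0 : a ≠ c) (h1 : b ≠ d) :
    phase F.pairDisc (Conf.pathPair p q h h0 h1) = 2 * turn fun t => (p t : ℂ) - q t := by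
  have hc : Continuous fun t => (p t : ℂ) - q t := by fun_prop
  have n0 : ∀ t, (p t : ℂ) - q t ≠ 0 := fun t e => h t (Subtype.ext (sub_eq_zero.mp e))
  have e : ∀ t, (F.pairDisc (Conf.pathPair p q h h0 h1 t) : ℂ) =
      - (((p t : ℂ) - q t) * ((p t : ℂ) - q t)) := fun t => F.coe_pairDisc _ _ (h t)
  simp only [phase, e]
  rw [turn_neg (by fun_prop) (fun t => mul_ne_zero (n0 t) (n0 t)), turn_mul hc hc n0 n0]
  ring

/-- The discriminant of three points factors over the three pairs, so `Ψ²_V` differs from `Φ` only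
by the windings of the two points about `V`. -/
theorem phase_tripleDisc (V : Puncture) {a b c d : F.M} (p : Path a b) (q : Path c d)
    (h : ∀ t, p t ≠ q t) (h0 : a ≠ c) (h1 : b ≠ d) :
    phase (F.tripleDisc V) (Conf.pathPair p q h h0 h1) =
      phase F.pairDisc (Conf.pathPair p q h h0 h1) +
      phase (F.pointDisc V) p + phase (F.pointDisc V) q := by
  have hp : Continuous fun t => (p t : ℂ) - F.position V := by fun_prop
  have hq : Continuous fun t => (q t : ℂ) - F.position V := by fun_prop
  have p0 : ∀ t, (p t : ℂ) - F.position V ≠ 0 := fun t => F.sub_position_ne V _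
  have q0 : ∀ t, (q t : ℂ) - F.position V ≠ 0 := fun t => F.sub_position_ne V _
  have e : ∀ t, (F.tripleDisc V (Conf.pathPair p q h h0 h1 t) : ℂ) =
      F.pairDisc (Conf.pathPair p q h h0 h1 t) *
      (((p t : ℂ) - F.position V) * ((p t : ℂ) - F.position V) *
      (((q t : ℂ) - F.position V) * ((q t : ℂ) - F.position V))) :=
    fun t => F.coe_tripleDisc V _ _ (h t)
  have hD : Continuous fun t => (F.pairDisc (Conf.pathPair p q h h0 h1 t) : ℂ) :=
    (continuous_subtype_val.comp F.pairDisc.continuous).comp (Conf.pathPair p q h h0 h1).continuous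
  rw [phase_pointDisc, phase_pointDisc]
  simp only [phase, e]
  rw [turn_mul hD (by fun_prop) (fun t => (F.pairDisc _).2)
      (fun t => mul_ne_zero (mul_ne_zero (p0 t) (p0 t)) (mul_ne_zero (q0 t) (q0 t))),
    turn_mul (by fun_prop) (by fun_prop) (fun t => mul_ne_zero (p0 t) (p0 t))
      (fun t => mul_ne_zero (q0 t) (q0 t)), turn_mul hp hp p0 p0, turn_mul hq hq q0 q0]
  ring

/-- The minus sign is the inverse in `exponentSum`: a clockwise half twist is positive but winds the
discriminant by `-1`. -/
theorem two_pi_mul_Phi {c : Conf 2 F.M} (γ : Path c c) :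
    2 * Real.pi * F.Phi γ = - phase F.pairDisc γ := by
  have h : F.Phi γ = - ofLoop (γ.map F.pairDisc.continuous) := rfl
  rw [h, ← two_pi_mul_ofLoop]
  push_cast
  ring

theorem two_pi_mul_PsiTwo (V : Puncture) {c : Conf 2 F.M} (γ : Path c c) :
    2 * Real.pi * F.PsiTwo V γ = - phase (F.tripleDisc V) γ := by
  have h : F.PsiTwo V γ = - ofLoop (γ.map (F.tripleDisc V).continuous) := rfl
  rw [h, ← two_pi_mul_ofLoop]
  push_cast
  ring

theorem two_pi_mul_PsiOne (V : Puncture) {x : F.M} (γ : Path x x) :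
    2 * Real.pi * ((F.PsiOne V x (.fromPath (.mk γ))).toAdd : ℤ) = - phase (F.pointDisc V) γ := by
  have h : (F.PsiOne V x (.fromPath (.mk γ))).toAdd =
    - ofLoop (γ.map (F.pointDisc V).continuous) := rfl
  rw [h, ← two_pi_mul_ofLoop]
  push_cast
  ring

end KnotFraction

/-! ## Explicit changes of the argument -/

namespace Winding

open unitInterval Complex

/-- The argument of `z` or of `-z`, whichever lies in the right half plane. -/
noncomputable def sideArg (z : ℂ) : ℝ := if 0 < z.re then arg z else arg (-z)

theorem sideArg_conj {z : ℂ} (h : z.re ≠ 0) :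
    sideArg (starRingEnd ℂ z) = - sideArg z := by
  have key : ∀ w : ℂ, 0 < w.re → arg (starRingEnd ℂ w) = - arg w := by
    intro w hw
    rw [arg_conj, if_neg]
    intro e
    linarith [(arg_eq_pi_iff.mp e).1]
  simp only [sideArg, conj_re]
  split_ifs with h1
  · exact key z h1
  · have := lt_of_le_of_ne (not_lt.mp h1) h
    rw [← map_neg, key (-z) (by simpa using this)]

theorem sideArg_of_im_eq_zero {z : ℂ} (h : z.re ≠ 0) (h0 : z.im = 0) : sideArg z = 0 := by
  have := sideArg_conj h
  rw [conj_eq_iff_im.mpr h0] at this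
  linarith

theorem turn_of_re_pos {f : I → ℂ} (hf : Continuous f) (h : ∀ t, 0 < (f t).re) :
    turn f = sideArg (f 1) - sideArg (f 0) := by
  rw [turn_of_mem_slitPlane hf (fun t => Or.inl (h t)), sideArg, sideArg, if_pos (h 1),
    if_pos (h 0)]

theorem turn_of_re_neg {f : I → ℂ} (hf : Continuous f) (h : ∀ t, (f t).re < 0) :
    turn f = sideArg (f 1) - sideArg (f 0) := by
  have f0 : ∀ t, f t ≠ 0 := fun t e => by simpa [e] using h t
  rw [← turn_neg hf f0, turn_of_mem_slitPlane (by fun_prop) (fun t => Or.inl (by simpa using h t)),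
    sideArg, sideArg, if_neg (h 1).le.not_gt, if_neg (h 0).le.not_gt]

/-- This separates an end term, which will cancel in loops, from a count of half turns that records
only on which side of the imaginary axis `z` lies. -/
theorem arg_eq_sideArg_of_im_pos {z : ℂ} (h : 0 < z.im) (h0 : z.re ≠ 0) :
    arg z = sideArg z + Real.pi * if z.re < 0 then 1 else 0 := by
  rcases lt_or_gt_of_ne h0 with hr | hr
  · rw [sideArg, if_neg hr.le.not_gt, if_pos hr, arg_neg_eq_arg_sub_pi_of_im_pos h]
    ring
  · rw [sideArg, if_pos hr, if_neg hr.le.not_gt]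
    ring

theorem arg_eq_sideArg_of_im_neg {z : ℂ} (h : z.im < 0) (h0 : z.re ≠ 0) :
    arg z = sideArg z - Real.pi * if z.re < 0 then 1 else 0 := by
  rcases lt_or_gt_of_ne h0 with hr | hr
  · rw [sideArg, if_neg hr.le.not_gt, if_pos hr, arg_neg_eq_arg_add_pi_of_im_neg h]
    ring
  · rw [sideArg, if_pos hr, if_neg hr.le.not_gt]
    ring

/-- The change of the argument along a path on one side of the real axis. -/
theorem turn_of_im_ne_zero {f : I → ℂ} (hf : Continuous f) {s : ℝ} (hs : s = 1 ∨ s = -1)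
    (h : ∀ t, 0 < s * (f t).im) (h0 : (f 0).re ≠ 0) (h1 : (f 1).re ≠ 0) :
    turn f = sideArg (f 1) - sideArg (f 0) +
      Real.pi * (s * ((if (f 1).re < 0 then 1 else 0) - (if (f 0).re < 0 then 1 else 0))) := by
  rw [turn_of_mem_slitPlane hf (fun t => Or.inr (by
    intro e
    simpa [e] using h t))]
  rcases hs with rfl | rfl
  · simp only [one_mul] at h
    rw [arg_eq_sideArg_of_im_pos (h 0) h0, arg_eq_sideArg_of_im_pos (h 1) h1]
    ring
  · simp only [neg_one_mul, neg_pos] at h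
    rw [arg_eq_sideArg_of_im_neg (h 0) h0, arg_eq_sideArg_of_im_neg (h 1) h1]
    ring

/-- Multiplication by `s` moves the path into the closed right half plane without `0`, which is
contained in the slit plane. Touching the imaginary axis is allowed because the chords considered
below start or end vertically. -/
theorem turn_of_re_nonneg {f : I → ℂ} (hf : Continuous f) (f0 : ∀ t, f t ≠ 0) {s : ℝ} (hs : s ≠ 0)
    (h : ∀ t, 0 ≤ s * (f t).re) : turn f = arg (s * f 1) - arg (s * f 0) := by
  have hs' : (s : ℂ) ≠ 0 := by exact_mod_cast hs
  rw [← turn_const_mul hf f0 hs', turn_of_mem_slitPlane (by fun_prop)]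
  intro t
  rw [mem_slitPlane_iff, re_ofReal_mul, im_ofReal_mul]
  by_contra! hc
  refine mul_ne_zero hs' (f0 t) (Complex.ext ?_ ?_)
  · rw [re_ofReal_mul]
    exact le_antisymm hc.1 (h t)
  · rw [im_ofReal_mul]
    exact hc.2

theorem arg_mk_zero_of_pos {y : ℝ} (h : 0 < y) : arg ⟨0, y⟩ = Real.pi / 2 :=
  arg_eq_pi_div_two_iff.mpr ⟨rfl, h⟩

theorem arg_mk_zero_of_neg {y : ℝ} (h : y < 0) : arg ⟨0, y⟩ = -(Real.pi / 2) :=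
  (arg_eq_neg_pi_div_two_iff (z := ⟨0, y⟩)).mpr ⟨rfl, h⟩

end Winding

/-! ### Winding of the curve about a puncture -/

namespace KnotFraction

open unitInterval Winding

variable (F : KnotFraction)

/-- The sign of the half plane in which the curve runs from the `k`-th to the next strand. -/
def side (k : ℕ) : ℤ := if Even k then 1 else -1

theorem side_eq (k : ℕ) : side k = 1 ∨ side k = -1 := by
  rw [side]
  split_ifs <;> simp

/-- Even strands run upwards and odd ones downwards, so a strand starts in the half plane opposite
to the semicircle that follows it. -/
theorem height_onTop_two_mul (k : ℕ) : height (onTop (2 * k)) = - side k := by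
  rw [side, height, onTop]
  simp only [Nat.even_iff, decide_eq_true_eq]
  split_ifs <;> first | omega | simp

theorem height_onTop_two_mul_add_one (k : ℕ) : height (onTop (2 * k + 1)) = side k := by
  rw [onTop_succ_of_even (even_two_mul k), height_not, height_onTop_two_mul, neg_neg]

theorem height_onTop_of_odd {n : ℕ} (h : ¬ Even n) : height (onTop n) = side (n / 2) := by
  rw [← height_onTop_two_mul_add_one, show 2 * (n / 2) + 1 = n by rw [Nat.even_iff] at h; omega]

/-- Whether the `k`-th strand lies to the left of the puncture `V`. -/
def leftOf (V : Puncture) (k : ℕ) : ℤ := if F.strand k < F.position V then 1 else 0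

/-- Twice the winding number about `V` of the curve from the crossing of the real axis by the first
strand to the one by the `k`-th strand, up to a contribution of the end points. -/
def halfTurns (V : Puncture) (k : ℕ) : ℤ :=
  ∑ i ∈ Finset.range k, side i * (F.leftOf V (i + 1) - F.leftOf V i)

/-- The argument, up to multiples of `π`, of the point at height `y` on the `k`-th strand, seen from
the puncture `V`. -/
noncomputable def ptArg (V : Puncture) (k : ℕ) (y : ℝ) : ℝ := sideArg ((F.pt k y : ℂ) - F.position V)

theorem re_pt_sub (V : Puncture) (k : ℕ) (y : ℝ) :
    ((F.pt k y : ℂ) - F.position V).re = F.strand k - F.position V := by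
  simp [pt]

theorem im_pt_sub (V : Puncture) (k : ℕ) (y : ℝ) :
    ((F.pt k y : ℂ) - F.position V).im = y := by
  simp [pt]

theorem re_pt_sub_ne_zero (V : Puncture) (k : ℕ) (y : ℝ) :
    ((F.pt k y : ℂ) - F.position V).re ≠ 0 := by
  rw [re_pt_sub]
  exact sub_ne_zero.mpr (F.strand_ne_position k V)

theorem ptArg_zero (V : Puncture) (k : ℕ) : F.ptArg V k 0 = 0 :=
  sideArg_of_im_eq_zero (F.re_pt_sub_ne_zero V k 0) (F.im_pt_sub V k 0)

/-- By reflection in the real axis, the end terms of two points at opposite heights on one strand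
cancel. -/
theorem ptArg_neg (V : Puncture) (k : ℕ) (y : ℝ) : F.ptArg V k (-y) = - F.ptArg V k y := by
  rw [ptArg, ptArg, ← sideArg_conj (F.re_pt_sub_ne_zero V k y)]
  congr 1
  apply Complex.ext <;> simp [pt]

/-- A path that stays on one side of the vertical line through `V` makes no half turn about `V`, so
only the end terms remain. -/
theorem phase_of_re_eq (V : Puncture) {k l : ℕ} {y y' : ℝ} (p : Path (F.pt k y) (F.pt l y'))
    (h : (∀ t, 0 < ((p t : ℂ) - F.position V).re) ∨ ∀ t, ((p t : ℂ) - F.position V).re < 0) :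
    phase (F.pointDisc V) p = 2 * (F.ptArg V l y' - F.ptArg V k y) := by
  rw [phase_pointDisc]
  rcases h with h | h
  · rw [turn_of_re_pos (by fun_prop) h, p.source, p.target]
    rfl
  · rw [turn_of_re_neg (by fun_prop) h, p.source, p.target]
    rfl

theorem phase_of_re_const (V : Puncture) {k l m : ℕ} {y y' : ℝ} (p : Path (F.pt k y) (F.pt l y'))
    (h : ∀ t, (p t : ℂ).re = F.strand m) :
    phase (F.pointDisc V) p = 2 * (F.ptArg V l y' - F.ptArg V k y) := by
  apply F.phase_of_re_eq V p
  rcases lt_or_gt_of_ne (F.strand_ne_position m V) with h' | h'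
  · right
    intro t
    simpa [h t] using h'
  · left
    intro t
    simpa [h t] using h'

theorem phase_vertical (V : Puncture) (k : ℕ) (y y' : ℝ) :
    phase (F.pointDisc V) (F.vertical k y y') = 2 * (F.ptArg V k y' - F.ptArg V k y) :=
  F.phase_of_re_const V (m := k) _ (fun _ => rfl)

/-- A vertical piece makes no half turn. A semicircle stays on one side of the real axis and makes a
half turn exactly when it passes from one side of `V` to the other, counterclockwise if it runs
leftwards above or rightwards below. -/
theorem phase_step (V : Puncture) (n : ℕ) :
    phase (F.pointDisc V) (F.step n) =
      2 * (F.ptArg V ((n + 1) / 2) (height (onTop (n + 1))) - F.ptArg V (n / 2) (height (onTop n)) +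
        Real.pi * (F.halfTurns V ((n + 1) / 2) - F.halfTurns V (n / 2))) := by
  by_cases h : Even n
  · have := F.phase_of_re_const V (m := n / 2) (F.step n) (fun t => F.re_stepFun_of_even h t)
    refine this.trans ?_
    rw [half_succ_of_even h]
    ring
  · have hs : ((side (n / 2) : ℤ) : ℝ) = 1 ∨ ((side (n / 2) : ℤ) : ℝ) = -1 := by
      exact_mod_cast side_eq (n / 2)
    have hs2 : ((side (n / 2) : ℤ) : ℝ) * side (n / 2) = 1 := by
      rcases hs with hs | hs <;> rw [hs] <;> norm_num
    rw [phase_pointDisc, turn_of_im_ne_zero (by fun_prop) hs]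
    · rw [(F.step n).source, (F.step n).target]
      have e1 : (((F.vertex n : ℂ) - F.position V).re < 0) ↔ F.strand (n / 2) < F.position V := by
        rw [vertex, re_pt_sub, sub_neg]
        exact Int.cast_lt
      have e2 : (((F.vertex (n + 1) : ℂ) - F.position V).re < 0) ↔
          F.strand (n / 2 + 1) < F.position V := by
        rw [vertex, re_pt_sub, sub_neg, half_succ h]
        exact Int.cast_lt
      simp only [e1, e2, half_succ h, halfTurns, Finset.sum_range_succ, leftOf]
      rw [← half_succ h]
      change 2 * (F.ptArg V ((n + 1) / 2) (height (onTop (n + 1))) -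
        F.ptArg V (n / 2) (height (onTop n)) + _) = _
      push_cast
      ring
    · intro t
      have hr := F.half_width_pos n h
      have ht := sin_nonneg_of_unit t.2.1 t.2.2
      simp only [coe_step, Complex.sub_im, Complex.intCast_im, sub_zero, stepFun, if_neg h,
        height_onTop_of_odd h, ← mul_assoc, hs2, one_mul]
      positivity
    · rw [(F.step n).source]
      exact F.re_pt_sub_ne_zero V _ _
    · rw [(F.step n).target]
      exact F.re_pt_sub_ne_zero V _ _

theorem phase_along (V : Puncture) {n m : ℕ} (h : n ≤ m) :
    phase (F.pointDisc V) (F.along n m h) =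
      2 * (F.ptArg V (m / 2) (height (onTop m)) - F.ptArg V (n / 2) (height (onTop n)) +
        Real.pi * (F.halfTurns V (m / 2) - F.halfTurns V (n / 2))) := by
  obtain ⟨d, rfl⟩ := Nat.exists_eq_add_of_le h
  change phase (F.pointDisc V) (F.alongAux n (n + d - n)) = _
  rw [Nat.add_sub_cancel_left]
  clear h
  induction d with
  | zero =>
    rw [alongAux, phase_refl]
    simp
  | succ d ih =>
    rw [alongAux, phase_trans, ih, phase_step, Nat.add_assoc n d 1]
    ring

/-! ### Turning of the chord between consecutive points -/

theorem sign_strand_sub (k : ℕ) :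
    (F.strand (k + 1) - F.strand k).sign = 1 ∨ (F.strand (k + 1) - F.strand k).sign = -1 := by
  rcases lt_or_gt_of_ne (F.strand_ne_succ k) with h | h
  · left
    exact Int.sign_eq_one_of_pos (by omega)
  · right
    exact Int.sign_eq_neg_one_of_neg (by omega)

theorem diagTurn_ne_zero (n : ℕ) (t : I) : F.stepFun (n + 1) t - F.stepFun n t ≠ 0 :=
  fun e => F.step_ne_step_succ n t (Subtype.ext (sub_eq_zero.mp e).symm)

theorem arg_mul_two_I {s r : ℤ} (hs : s = 1 ∨ s = -1) (hr : r = 1 ∨ r = -1) :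
    Complex.arg ((s : ℝ) * ⟨0, 2 * (r : ℝ)⟩) = s * r * (Real.pi / 2) := by
  have e : ((s : ℝ) : ℂ) * ⟨0, 2 * (r : ℝ)⟩ = ⟨0, s * (2 * r)⟩ := by
    apply Complex.ext <;> simp
  rw [e]
  rcases hs with rfl | rfl <;> rcases hr with rfl | rfl
  · rw [arg_mk_zero_of_pos (by norm_num)]
    norm_num
  · rw [arg_mk_zero_of_neg (by norm_num)]
    norm_num
  · rw [arg_mk_zero_of_neg (by norm_num)]
    norm_num
  · rw [arg_mk_zero_of_pos (by norm_num)]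
    norm_num

/-- The rear point runs along strand `k` while the front point follows the semicircle to strand `k +
1`. The chord starts vertical, ends horizontal and keeps its real part of one sign in between, so it
makes a quarter turn. -/
theorem diagTurn_two_mul (k : ℕ) :
    F.diagTurn (2 * k) = - (Real.pi / 2 * (side k * (F.strand (k + 1) - F.strand k).sign)) := by
  have hsign := F.sign_strand_sub k
  set s := (F.strand (k + 1) - F.strand k).sign with hs
  have hpos : (0 : ℝ) < s * (F.strand (k + 1) - F.strand k) := by
    have : 0 < s * (F.strand (k + 1) - F.strand k) := by
      rw [hs, Int.sign_mul_self_eq_abs, abs_pos, sub_ne_zero]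
      exact (F.strand_ne_succ k).symm
    exact_mod_cast this
  have h1 : (2 * k + 1) / 2 = k := by omega
  have h2 : (2 * k + 1 + 1) / 2 = k + 1 := by omega
  have h3 : 2 * k / 2 = k := by omega
  have hodd : ¬ Even (2 * k + 1) := by simp
  rw [diagTurn, turn_of_re_nonneg (by fun_prop) (F.diagTurn_ne_zero _) (s := s)]
  · have e0 : F.stepFun (2 * k + 1) ((0 : I) : ℝ) - F.stepFun (2 * k) ((0 : I) : ℝ) =
        ⟨0, 2 * (side k : ℝ)⟩ := by
      rw [Set.Icc.coe_zero, stepFun_zero, stepFun_zero, vertex, vertex, h1, h3,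
        height_onTop_two_mul, height_onTop_two_mul_add_one]
      apply Complex.ext <;> simp [pt]
      ring
    have e1 : (((s : ℝ) : ℂ) * (F.stepFun (2 * k + 1) ((1 : I) : ℝ) -
        F.stepFun (2 * k) ((1 : I) : ℝ))) =
        ((s * (F.strand (k + 1) - F.strand k) : ℝ) : ℂ) := by
      rw [Set.Icc.coe_one, stepFun_one, stepFun_one, vertex, vertex, h1, h2,
        onTop_succ_of_odd hodd]
      apply Complex.ext <;> simp [pt]
    rw [e0, e1, Complex.arg_ofReal_of_nonneg hpos.le, arg_mul_two_I hsign (side_eq k)]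
    ring
  · rcases hsign with h | h <;> rw [h] <;> norm_num
  · intro t
    rw [Complex.sub_re, F.re_stepFun_of_even (even_two_mul k), stepFun, h1, h2, h3]
    have := Real.cos_le_one (Real.pi * t)
    calc (0 : ℝ) ≤ s * (F.strand (k + 1) - F.strand k) * ((1 - Real.cos (Real.pi * t)) / 2) :=
        mul_nonneg hpos.le (by linarith)
      _ = _ := by
        dsimp only
        ring

/-- The rear point now follows the semicircle while the front point runs along strand `k + 1`. The
chord goes from horizontal to vertical, a second quarter turn in the same direction. -/
theorem diagTurn_two_mul_add_one (k : ℕ) :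
    F.diagTurn (2 * k + 1) = - (Real.pi / 2 * (side k * (F.strand (k + 1) - F.strand k).sign)) := by
  have hsign := F.sign_strand_sub k
  set s := (F.strand (k + 1) - F.strand k).sign with hs
  have hpos : (0 : ℝ) < s * (F.strand (k + 1) - F.strand k) := by
    have : 0 < s * (F.strand (k + 1) - F.strand k) := by
      rw [hs, Int.sign_mul_self_eq_abs, abs_pos, sub_ne_zero]
      exact (F.strand_ne_succ k).symm
    exact_mod_cast this
  have h1 : (2 * k + 1) / 2 = k := by omega
  have h2 : (2 * k + 1 + 1) / 2 = k + 1 := by omega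
  have h3 : (2 * k + 1 + 1 + 1) / 2 = k + 1 := by omega
  have hodd : ¬ Even (2 * k + 1) := by simp
  have heven : Even (2 * k + 1 + 1) := ⟨k + 1, by ring⟩
  rw [diagTurn, turn_of_re_nonneg (by fun_prop) (F.diagTurn_ne_zero _) (s := s)]
  · have e0 : (((s : ℝ) : ℂ) * (F.stepFun (2 * k + 1 + 1) ((0 : I) : ℝ) -
        F.stepFun (2 * k + 1) ((0 : I) : ℝ))) =
        ((s * (F.strand (k + 1) - F.strand k) : ℝ) : ℂ) := by
      rw [Set.Icc.coe_zero, stepFun_zero, stepFun_zero, vertex, vertex, h1, h2,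
        onTop_succ_of_odd hodd]
      apply Complex.ext <;> simp [pt]
    have e1 : F.stepFun (2 * k + 1 + 1) ((1 : I) : ℝ) - F.stepFun (2 * k + 1) ((1 : I) : ℝ) =
        ⟨0, 2 * ((-side k : ℤ) : ℝ)⟩ := by
      rw [Set.Icc.coe_one, stepFun_one, stepFun_one, vertex, vertex, h2, h3,
        onTop_succ_of_even heven, height_not, onTop_succ_of_odd hodd,
        height_onTop_two_mul_add_one]
      apply Complex.ext <;> simp [pt]
      ring
    rw [e0, e1, Complex.arg_ofReal_of_nonneg hpos.le,
      arg_mul_two_I hsign (by rcases side_eq k with h | h <;> simp [h])]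
    push_cast
    ring
  · rcases hsign with h | h <;> rw [h] <;> norm_num
  · intro t
    rw [Complex.sub_re, F.re_stepFun_of_even heven, stepFun, h1, h2]
    have := Real.neg_one_le_cos (Real.pi * t)
    calc (0 : ℝ) ≤ s * (F.strand (k + 1) - F.strand k) * ((1 + Real.cos (Real.pi * t)) / 2) :=
        mul_nonneg hpos.le (by linarith)
      _ = _ := by
        dsimp only
        ring

/-- The parity of the number of punctures to the left of the `k`-th strand. -/
def parity (k : ℕ) : ℤ :=
  if (0 < F.strand k ∧ F.strand k < 2 * F.v) ∨ 2 * (F.u + F.v) < F.strand k then 1 else 0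

/-- The punctures cut the real axis into four intervals, with 3, 2, 1 and 0 punctures to the right.
-/
theorem region_cases (k : ℕ) :
    (F.strand k < 0 ∧ F.leftOf .Xminus k + (F.leftOf .Y k + F.leftOf .Xplus k) = 3 ∧
      F.parity k = 0) ∨
    (0 < F.strand k ∧ F.strand k < 2 * F.v ∧
      F.leftOf .Xminus k + (F.leftOf .Y k + F.leftOf .Xplus k) = 2 ∧ F.parity k = 1) ∨
    (2 * F.v < F.strand k ∧ F.strand k < 2 * (F.u + F.v) ∧
      F.leftOf .Xminus k + (F.leftOf .Y k + F.leftOf .Xplus k) = 1 ∧ F.parity k = 0) ∨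
    (2 * (F.u + F.v) < F.strand k ∧
      F.leftOf .Xminus k + (F.leftOf .Y k + F.leftOf .Xplus k) = 0 ∧ F.parity k = 1) := by
  -- Only the sum over `Y` and `X⁺` matters, so it is irrelevant which of the two is in the middle;
  -- this removes the case distinction on the parity of `v`.
  have hYX : F.leftOf .Y k + F.leftOf .Xplus k =
      (if F.strand k < 2 * F.v then 1 else 0) +
      (if F.strand k < 2 * (F.u + F.v) then 1 else 0) := by
    simp only [leftOf, position]
    by_cases hev : Even F.v <;> simp only [hev, if_true, if_false]
    exact add_comm _ _
  have hX : F.leftOf .Xminus k = if F.strand k < 0 then 1 else 0 := rfl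
  obtain ⟨c, hc⟩ := F.strand_odd k
  rw [hYX, hX, parity]
  split_ifs <;> omega

/-- Every semicircle is centred above or below the position of a puncture and so encloses one, two
or three of them. The chord makes one half turn, doubled here, as if exactly two were enclosed. The
excess or defect of one is made up by the change of `parity`, as one checks interval by interval. -/
theorem two_mul_side_mul_sign (k : ℕ) :
    -2 * (side k * (F.strand (k + 1) - F.strand k).sign) =
      side k * (F.leftOf .Xminus (k + 1) - F.leftOf .Xminus k) +
      side k * (F.leftOf .Y (k + 1) - F.leftOf .Y k) +
      side k * (F.leftOf .Xplus (k + 1) - F.leftOf .Xplus k) +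
      (F.parity (k + 1) - F.parity k) := by
  have m1 := F.strand_mem k
  have m2 := F.strand_mem (k + 1)
  have hu := F.v_lt_u
  have r1 := F.region_cases k
  have r2 := F.region_cases (k + 1)
  have hz : (F.strand k < F.strand (k + 1) ∧ (F.strand (k + 1) - F.strand k).sign = 1) ∨
      (F.strand (k + 1) < F.strand k ∧ (F.strand (k + 1) - F.strand k).sign = -1) := by
    rcases lt_or_gt_of_ne (F.strand_ne_succ k) with h | h
    · exact Or.inl ⟨h, Int.sign_eq_one_of_pos (by omega)⟩
    · exact Or.inr ⟨h, Int.sign_eq_neg_one_of_neg (by omega)⟩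
  by_cases hk : Even k
  · have hsum := F.strand_add_succ_of_even hk
    rw [side, if_pos hk]
    rcases hz with ⟨h1, h2⟩ | ⟨h1, h2⟩ <;> rw [h2] <;> omega
  · have hsum := F.strand_add_succ_of_odd hk
    rw [abs_lt, abs_lt] at hsum
    rw [side, if_neg hk]
    rcases hsum with hsum | hsum <;> rcases hz with ⟨h1, h2⟩ | ⟨h1, h2⟩ <;> rw [h2] <;> omega

/-- Parallel transport along the curve turns a pair of points by half the sum of the angles by which
the curve turns about the three punctures. -/
theorem two_mul_togetherTurn (k : ℕ) :
    2 * F.togetherTurn (2 * k) = Real.pi * (F.halfTurns .Xminus k + F.halfTurns .Y k +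
      F.halfTurns .Xplus k + (F.parity k - F.parity 0)) := by
  induction k with
  | zero => simp [togetherTurn, halfTurns]
  | succ k ih =>
    have e : F.togetherTurn (2 * (k + 1)) =
        F.togetherTurn (2 * k) + F.diagTurn (2 * k) + F.diagTurn (2 * k + 1) := by
      rw [togetherTurn, show 2 * (k + 1) = 2 * k + 1 + 1 by ring, Finset.sum_range_succ,
        Finset.sum_range_succ]
      rfl
    have h := congrArg (Int.cast : ℤ → ℝ) (F.two_mul_side_mul_sign k)
    push_cast at h
    rw [e, diagTurn_two_mul, diagTurn_two_mul_add_one]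
    simp only [halfTurns, Finset.sum_range_succ] at ih ⊢
    push_cast at ih ⊢
    linear_combination ih + Real.pi * h

end KnotFraction

/-! ## The loops -/

namespace KnotFraction

open unitInterval Winding

variable (F : KnotFraction)

/-! ### Loops in `M` -/

theorem coe_horizontal (k l : ℕ) (y : ℝ)
    (h : y ≠ 0 ∨ ((2 * F.v < F.strand k ∧ F.strand k < 2 * (F.u + F.v)) ∧
      2 * F.v < F.strand l ∧ F.strand l < 2 * (F.u + F.v))) (t : I) :
    (F.horizontal k l y h t : ℂ) = ⟨(1 - t) * F.strand k + t * F.strand l, y⟩ := rfl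

/-- No puncture has its position strictly between two crossings of `β`, so the segment stays on one
side of the vertical line through each puncture. -/
theorem phase_horizontal (V : Puncture) (a b : Fin F.u) (y : ℝ)
    (h : y ≠ 0 ∨ ((2 * F.v < F.strand (F.kappa a) ∧ F.strand (F.kappa a) < 2 * (F.u + F.v)) ∧
      2 * F.v < F.strand (F.kappa b) ∧ F.strand (F.kappa b) < 2 * (F.u + F.v))) :
    phase (F.pointDisc V) (F.horizontal (F.kappa a) (F.kappa b) y h) =
      2 * (F.ptArg V (F.kappa b) y - F.ptArg V (F.kappa a) y) := by
  apply F.phase_of_re_eq V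
  have hre : ∀ t, ((F.horizontal (F.kappa a) (F.kappa b) y h t : ℂ) - F.position V).re =
      (1 - (t : ℝ)) * (F.strand (F.kappa a) - F.position V) +
        t * (F.strand (F.kappa b) - F.position V) := by
    intro t
    rw [coe_horizontal, Complex.sub_re, Complex.intCast_re]
    ring
  simp only [hre]
  have ha := F.kappa_mem a
  have hb := F.kappa_mem b
  have hV : (F.position V < F.strand (F.kappa a) ∧ F.position V < F.strand (F.kappa b)) ∨
      (F.strand (F.kappa a) < F.position V ∧ F.strand (F.kappa b) < F.position V) := by
    rcases F.position_cases V with e | e | e <;> rw [e] <;> omega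
  have pos : ∀ (t : I) (x y : ℝ), 0 < x → 0 < y → 0 < (1 - (t : ℝ)) * x + t * y := by
    intro t x y hx hy
    rcases eq_or_lt_of_le t.2.1 with h0 | h0
    · rw [← h0]
      simpa using hx
    · have := mul_pos h0 hy
      have := mul_nonneg (sub_nonneg.mpr t.2.2) hx.le
      linarith
  rcases hV with ⟨h1, h2⟩ | ⟨h1, h2⟩
  · left
    intro t
    exact pos t _ _ (sub_pos.mpr (by exact_mod_cast h1)) (sub_pos.mpr (by exact_mod_cast h2))
  · right
    intro t
    have := pos t _ _ (sub_pos.mpr (show (F.strand (F.kappa a) : ℝ) < F.position V by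
      exact_mod_cast h1)) (sub_pos.mpr (show (F.strand (F.kappa b) : ℝ) < F.position V by
      exact_mod_cast h2))
    linarith

theorem phase_forward (V : Puncture) {k l : ℕ} (h : k < l) :
    phase (F.pointDisc V) (F.forward k l h) =
      2 * (Real.pi * (F.halfTurns V l - F.halfTurns V k)) := by
  rw [forward, phase_trans, phase_trans, halfOut, halfIn, phase_cast, phase_cast, phase_vertical,
    phase_vertical, phase_along, show (2 * k + 1) / 2 = k by omega, show 2 * l / 2 = l by omega,
    ptArg_zero, ptArg_zero]
  ring

theorem phase_eta (V : Puncture) (j i : Fin F.u) :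
    phase (F.pointDisc V) (F.eta j i) =
      2 * (Real.pi * (F.halfTurns V (F.kappa i) - F.halfTurns V (F.kappa j))) := by
  rw [eta]
  split_ifs with h h'
  · exact F.phase_forward V h
  · rw [phase_symm, F.phase_forward V h']
    ring
  · rw [phase_cast, phase_refl, show F.kappa j = F.kappa i by omega]
    ring

theorem phase_gamma (V : Puncture) (j i : Fin F.u) :
    phase (F.pointDisc V) (F.gamma j i) =
      2 * (Real.pi * (F.halfTurns V (F.kappa i) - F.halfTurns V (F.kappa j))) := by
  rw [gamma, phase_trans, phase_eta, phase_horizontal, ptArg_zero, ptArg_zero]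
  ring

/-- Both ends of the curve segment lie on the real axis, where the end terms vanish, and the way
back along `β` contributes nothing. The order of the difference reflects the clockwise sign
convention. -/
theorem PsiOne_gamma (V : Puncture) (j i : Fin F.u) :
    (F.PsiOne V _ (.fromPath (.mk (F.gamma j i)))).toAdd =
      F.halfTurns V (F.kappa j) - F.halfTurns V (F.kappa i) := by
  have h := F.two_pi_mul_PsiOne V (F.gamma j i)
  rw [phase_gamma] at h
  have h2 : (2 * Real.pi : ℝ) ≠ 0 := by positivity
  have h3 := mul_left_cancel₀ h2 (h.trans (show _ = 2 * Real.pi *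
    ((F.halfTurns V (F.kappa j) - F.halfTurns V (F.kappa i) : ℤ) : ℝ) by push_cast; ring))
  exact_mod_cast h3

/-- Evenness of `Ψ¹_V` makes the integer division by 2 exact. -/
theorem two_mul_Psi_singleton (V : Puncture) (j i : Fin F.u) :
    2 * F.Psi {V} (F.gamma j i) = F.halfTurns V (F.kappa j) - F.halfTurns V (F.kappa i) := by
  rw [← PsiOne_gamma, Psi, Finset.sum_singleton]
  exact Int.mul_ediv_cancel' (F.even_PsiOne V _).two_dvd

theorem two_mul_Psi_pair {V W : Puncture} (h : V ≠ W) (j i : Fin F.u) :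
    2 * F.Psi {V, W} (F.gamma j i) =
      F.halfTurns V (F.kappa j) - F.halfTurns V (F.kappa i) +
      (F.halfTurns W (F.kappa j) - F.halfTurns W (F.kappa i)) := by
  rw [← PsiOne_gamma, ← PsiOne_gamma, Psi, Finset.sum_pair h]
  exact Int.mul_ediv_cancel' ((F.even_PsiOne V _).add (F.even_PsiOne W _)).two_dvd

/-! ### Paths in `Conf²(M)` -/

/-- The change of the sum of the arguments of the squares of the differences of the two points and
the puncture `V`. -/
noncomputable def crossPhase (V : Puncture) {c d : Conf 2 F.M} (γ : Path c d) : ℝ :=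
  phase (F.tripleDisc V) γ - phase F.pairDisc γ

theorem crossPhase_trans (V : Puncture) {a b c : Conf 2 F.M} (γ : Path a b) (δ : Path b c) :
    F.crossPhase V (γ.trans δ) = F.crossPhase V γ + F.crossPhase V δ := by
  simp only [crossPhase, phase_trans]
  ring

theorem crossPhase_symm (V : Puncture) {a b : Conf 2 F.M} (γ : Path a b) :
    F.crossPhase V γ.symm = - F.crossPhase V γ := by
  simp only [crossPhase, phase_symm]
  ring

theorem crossPhase_refl (V : Puncture) (a : Conf 2 F.M) : F.crossPhase V (Path.refl a) = 0 := by
  simp only [crossPhase, phase_refl, sub_zero]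

theorem crossPhase_cast (V : Puncture) {a b a' b' : Conf 2 F.M} (γ : Path a b) (ha : a' = a)
    (hb : b' = b) : F.crossPhase V (γ.cast ha hb) = F.crossPhase V γ := rfl

theorem crossPhase_pathPair (V : Puncture) {a b c d : F.M} (p : Path a b) (q : Path c d)
    (h : ∀ t, p t ≠ q t) (h0 : a ≠ c) (h1 : b ≠ d) :
    F.crossPhase V (Conf.pathPair p q h h0 h1) =
      phase (F.pointDisc V) p + phase (F.pointDisc V) q := by
  rw [crossPhase, phase_tripleDisc]
  ring

theorem phase_pairDisc_comm {a b c d : F.M} (p : Path a b) (q : Path c d) (h : ∀ t, p t ≠ q t)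
    (h0 : a ≠ c) (h1 : b ≠ d) :
    phase F.pairDisc (Conf.pathPair p q h h0 h1) = 2 * turn fun t => (q t : ℂ) - p t := by
  rw [phase_pairDisc, ← turn_neg (by fun_prop) (fun t e => h t (Subtype.ext (sub_eq_zero.mp e)))]
  simp only [neg_sub]

theorem turn_symm_sub {a b : F.M} (p : Path a b) (c : F.M) (h : ∀ t, p t ≠ c) :
    turn (fun t => (p.symm t : ℂ) - c) = - turn fun t => (p t : ℂ) - c :=
  turn_symm (f := fun t => (p t : ℂ) - c) (by fun_prop)
    (fun t e => h t (Subtype.ext (sub_eq_zero.mp e)))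

/-- The argument, up to a constant, of the `n`-th vertex seen from the puncture `V`, as a continuous
function on the curve. -/
noncomputable def vertexArg (V : Puncture) (n : ℕ) : ℝ :=
  F.ptArg V (n / 2) (height (onTop n)) + Real.pi * F.halfTurns V (n / 2)

theorem phase_along_eq (V : Puncture) {n m : ℕ} (h : n ≤ m) :
    phase (F.pointDisc V) (F.along n m h) = 2 * (F.vertexArg V m - F.vertexArg V n) := by
  rw [phase_along, vertexArg, vertexArg]
  ring

theorem phase_step_eq (V : Puncture) (n : ℕ) :
    phase (F.pointDisc V) (F.step n) = 2 * (F.vertexArg V (n + 1) - F.vertexArg V n) := by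
  rw [phase_step, vertexArg, vertexArg]
  ring

/-- The two ends of a strand are at opposite heights, so their end terms cancel and only half turns
remain. -/
theorem vertexArg_add_succ (V : Puncture) (k : ℕ) :
    F.vertexArg V (2 * k) + F.vertexArg V (2 * k + 1) = 2 * (Real.pi * F.halfTurns V k) := by
  rw [vertexArg, vertexArg, show 2 * k / 2 = k by omega, show (2 * k + 1) / 2 = k by omega,
    onTop_succ_of_even (even_two_mul k), height_not, ptArg_neg]
  ring

theorem vertexArg_idx (V : Puncture) (k : ℕ) (b : Bool) :
    F.vertexArg V (idx k b) = F.ptArg V k (height b) + Real.pi * F.halfTurns V k := by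
  have h := idx_bounds k b
  have hb : onTop (idx k b) = b := by
    rw [idx]
    split_ifs with h
    · exact h
    · rw [onTop_succ_of_even (even_two_mul k)]
      cases b <;> simp_all
  rw [vertexArg, hb, show idx k b / 2 = k by omega]

/-! ### Phases of the slides -/

/-- Both legs change `pairArg` by the difference of its values, so the intermediate pair cancels;
the factor 2 comes from the square in `pairDisc`. -/
theorem phase_slideForward (a c f : ℕ) (hf : f < 2 * (F.u + F.v)) (ha : a < 2 * f)
    (hc : 2 * f ≤ c ∧ c ≤ 2 * f + 1) (hac : F.vertex a ≠ F.vertex c) :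
    phase F.pairDisc (F.slideForward a c f hf ha hc hac) =
      2 * (F.togetherTurn (2 * f) - F.pairArg a c) := by
  rw [slideForward, phase_trans]
  refine (congrArg₂ HAdd.hAdd (F.phase_pairDisc_comm _ _ _ _ _)
    (F.phase_pairDisc _ _ _ _ _)).trans ?_
  simp only [Path.refl_apply]
  rw [F.turn_along_sub_of_lt _ (by omega) (by omega), F.turn_along_sub_of_gt _ (by omega) (by omega),
    pairArg_succ_self]
  ring

theorem crossPhase_slideForward (V : Puncture) (a c f : ℕ) (hf : f < 2 * (F.u + F.v))
    (ha : a < 2 * f) (hc : 2 * f ≤ c ∧ c ≤ 2 * f + 1) (hac : F.vertex a ≠ F.vertex c) :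
    F.crossPhase V (F.slideForward a c f hf ha hc hac) =
      2 * (2 * (Real.pi * F.halfTurns V f) - F.vertexArg V a - F.vertexArg V c) := by
  rw [slideForward, crossPhase_trans]
  refine (congrArg₂ HAdd.hAdd (F.crossPhase_pathPair V _ _ _ _ _)
    (F.crossPhase_pathPair V _ _ _ _ _)).trans ?_
  rw [phase_refl, phase_refl, phase_along_eq, phase_along_eq, ← vertexArg_add_succ]
  ring

/-- The same potential is used with the roles of front and rear exchanged: the point at `c` is now
the rear one, and both legs are traversed backwards. -/
theorem phase_slideBackward (a c f : ℕ) (ha' : a < 4 * (F.u + F.v)) (ha : 2 * f + 1 < a)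
    (hc : 2 * f ≤ c ∧ c ≤ 2 * f + 1) (hac : F.vertex a ≠ F.vertex c) :
    phase F.pairDisc (F.slideBackward a c f ha' ha hc hac) =
      2 * (F.togetherTurn (2 * f) - F.pairArg c a) := by
  rw [slideBackward, phase_trans]
  refine (congrArg₂ HAdd.hAdd (F.phase_pairDisc_comm _ _ _ _ _)
    (F.phase_pairDisc _ _ _ _ _)).trans ?_
  simp only [Path.refl_apply]
  rw [F.turn_symm_sub _ _ (fun t => F.along_ne_vertex _ (by omega) (by omega) (by omega) t),
    F.turn_symm_sub _ _ (fun t => F.along_ne_vertex _ (by omega) (by omega) (by omega) t),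
    F.turn_along_sub_of_gt _ (by omega) (by omega), F.turn_along_sub_of_lt _ (by omega) (by omega),
    pairArg_succ_self]
  ring

theorem crossPhase_slideBackward (V : Puncture) (a c f : ℕ) (ha' : a < 4 * (F.u + F.v))
    (ha : 2 * f + 1 < a) (hc : 2 * f ≤ c ∧ c ≤ 2 * f + 1) (hac : F.vertex a ≠ F.vertex c) :
    F.crossPhase V (F.slideBackward a c f ha' ha hc hac) =
      2 * (2 * (Real.pi * F.halfTurns V f) - F.vertexArg V a - F.vertexArg V c) := by
  rw [slideBackward, crossPhase_trans]
  refine (congrArg₂ HAdd.hAdd (F.crossPhase_pathPair V _ _ _ _ _)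
    (F.crossPhase_pathPair V _ _ _ _ _)).trans ?_
  rw [phase_refl, phase_refl, phase_symm, phase_symm, phase_along_eq, phase_along_eq, ← vertexArg_add_succ]
  ring

/-- The argument, up to a constant, of the difference of the two points of the base point for
`κ_j, κ_i`, as a continuous function on pairs of points of the curve. -/
noncomputable def baseArg (j i : Fin F.u) : ℝ :=
  F.pairArg
    (min (idx (F.kappa j) (decide (j < i))) (idx (F.kappa i) !(decide (j < i))))
    (max (idx (F.kappa j) (decide (j < i))) (idx (F.kappa i) !(decide (j < i))))

theorem baseArg_self (i : Fin F.u) : F.baseArg i i = F.togetherTurn (2 * F.kappa i) := by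
  rw [← pairArg_succ_self, baseArg]
  have h1 := idx_bounds (F.kappa i) (decide (i < i))
  have h2 := idx_bounds (F.kappa i) (!decide (i < i))
  -- Both indices lie in `{2k, 2k + 1}` and differ, so their minimum and maximum are consecutive.
  have hne : idx (F.kappa i) (decide (i < i)) ≠ idx (F.kappa i) (!decide (i < i)) := by
    intro e
    have := congrArg F.vertex e
    rw [vertex_idx, vertex_idx] at this
    exact F.pt_ne_of_height _ _ (height_ne_height_not _) this
  congr 1 <;> omega

theorem decide_lt_eq_not {i j : Fin F.u} (h : i ≠ j) : decide (i < j) = !decide (j < i) := by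
  rw [← decide_not, decide_eq_decide, not_lt]
  exact ⟨le_of_lt, fun h' => lt_of_le_of_ne h' h⟩

/-- The base point is an unordered pair: exchanging `j` and `i` also exchanges the copies of `β`
assigned to them, so the same two vertices occur. -/
theorem baseArg_comm (j i : Fin F.u) : F.baseArg j i = F.baseArg i j := by
  by_cases h : i = j
  · rw [h]
  · rw [baseArg, baseArg, F.decide_lt_eq_not h, Bool.not_not, min_comm, max_comm]

theorem kappa_injective : Function.Injective F.kappa := by
  intro i j h
  have h1 := F.strand_kappa i
  have h2 := F.strand_kappa j
  rw [h] at h1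
  exact Fin.ext (by omega)

/-- As a difference of values of one potential, the result has the same form whether `κ_j` comes
before or after `κ_i` on the curve. -/
theorem phase_slide (j i : Fin F.u) :
    phase F.pairDisc (F.slide j i) = 2 * (F.togetherTurn (2 * F.kappa i) - F.baseArg j i) := by
  have h1 := idx_bounds (F.kappa j) (decide (j < i))
  have h2 := idx_bounds (F.kappa i) (!decide (j < i))
  rw [slide]
  split_ifs with h h'
  · refine (phase_cast _ _ _ _).trans ?_
    rw [phase_slideForward, baseArg, min_eq_left (by omega), max_eq_right (by omega)]
  · refine (phase_cast _ _ _ _).trans ?_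
    rw [phase_slideBackward, baseArg, min_eq_right (by omega), max_eq_left (by omega)]
  · obtain rfl : j = i := F.kappa_injective (by omega)
    rw [phase_cast, phase_refl, baseArg_self]
    ring

theorem crossPhase_slide (V : Puncture) (j i : Fin F.u) :
    F.crossPhase V (F.slide j i) =
      2 * (Real.pi * (F.halfTurns V (F.kappa i) - F.halfTurns V (F.kappa j)) -
        F.ptArg V (F.kappa j) (height (decide (j < i))) -
        F.ptArg V (F.kappa i) (height !(decide (j < i)))) := by
  rw [slide]
  split_ifs with h h'
  · refine (F.crossPhase_cast V _ _ _).trans ?_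
    rw [crossPhase_slideForward, vertexArg_idx, vertexArg_idx]
    ring
  · refine (F.crossPhase_cast V _ _ _).trans ?_
    rw [crossPhase_slideBackward, vertexArg_idx, vertexArg_idx]
    ring
  · rw [crossPhase_cast, crossPhase_refl, height_not, show F.kappa j = F.kappa i by omega, ptArg_neg]
    ring

/-- Each step contributes one `diagTurn`, and `togetherTurn` is their sum. -/
theorem phase_slideTogetherAux (n d : ℕ) :
    phase F.pairDisc (F.slideTogetherAux n d) =
      2 * (F.togetherTurn (n + d) - F.togetherTurn n) := by
  induction d with
  | zero =>
    rw [slideTogetherAux, phase_refl]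
    simp
  | succ d ih =>
    rw [slideTogetherAux, phase_trans, ih, phase_pairDisc_comm, ← Nat.add_assoc n d 1, togetherTurn,
      togetherTurn, togetherTurn, Finset.sum_range_succ, diagTurn]
    simp only [coe_step]
    ring

theorem crossPhase_slideTogetherAux (V : Puncture) (n d : ℕ) :
    F.crossPhase V (F.slideTogetherAux n d) =
      2 * (F.vertexArg V (n + d) + F.vertexArg V (n + d + 1) -
        (F.vertexArg V n + F.vertexArg V (n + 1))) := by
  induction d with
  | zero =>
    rw [slideTogetherAux, crossPhase_refl]
    simp
  | succ d ih =>
    rw [slideTogetherAux, crossPhase_trans, ih, crossPhase_pathPair, phase_step_eq, phase_step_eq,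
      ← Nat.add_assoc n d 1]
    ring

theorem phase_slideTogether {k l : ℕ} (h : k ≤ l) :
    phase F.pairDisc (F.slideTogether k l h) =
      2 * (F.togetherTurn (2 * l) - F.togetherTurn (2 * k)) := by
  rw [slideTogether, phase_cast, phase_slideTogetherAux, show 2 * k + (2 * l - 2 * k) = 2 * l by omega]

theorem crossPhase_slideTogether (V : Puncture) {k l : ℕ} (h : k ≤ l) :
    F.crossPhase V (F.slideTogether k l h) =
      4 * (Real.pi * (F.halfTurns V l - F.halfTurns V k)) := by
  rw [slideTogether, crossPhase_cast, crossPhase_slideTogetherAux,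
    show 2 * k + (2 * l - 2 * k) = 2 * l by omega, vertexArg_add_succ, vertexArg_add_succ]
  ring

theorem phase_slideBoth (i : Fin F.u) :
    phase F.pairDisc (F.slideBoth i) =
      2 * (F.togetherTurn (2 * F.kappa F.kappaOmega) - F.togetherTurn (2 * F.kappa i)) := by
  by_cases h : F.kappa i ≤ F.kappa F.kappaOmega
  · exact (congrArg (phase F.pairDisc) (dif_pos h)).trans (F.phase_slideTogether h)
  · refine (congrArg (phase F.pairDisc) (dif_neg h)).trans
      ((phase_symm F.pairDisc (F.slideTogether _ _ (le_of_not_ge h))).trans ?_)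
    rw [phase_slideTogether]
    ring

theorem crossPhase_slideBoth (V : Puncture) (i : Fin F.u) :
    F.crossPhase V (F.slideBoth i) =
      4 * (Real.pi * (F.halfTurns V (F.kappa F.kappaOmega) - F.halfTurns V (F.kappa i))) := by
  by_cases h : F.kappa i ≤ F.kappa F.kappaOmega
  · exact (congrArg (F.crossPhase V) (dif_pos h)).trans (F.crossPhase_slideTogether V h)
  · refine (congrArg (F.crossPhase V) (dif_neg h)).trans
      ((F.crossPhase_symm V (F.slideTogether _ _ (le_of_not_ge h))).trans ?_)
    rw [crossPhase_slideTogether]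
    ring

/-- The change of the argument of the difference of the two points returning along the copies of `β`
to the base point for `κ_j, κ_i` from a configuration with the same point on both copies. -/
noncomputable def returnTurn (j i : Fin F.u) : ℝ :=
  turn fun t => ⟨t * (F.strand (F.kappa j) - F.strand (F.kappa i)),
    2 * height (decide (j < i))⟩

/-- The position of strand `l` drops out of the difference of the two points, so the loops `γ̃` and
`γ²` have the same return term. -/
theorem phase_returnTo (l j i : Fin F.u) :
    phase F.pairDisc (F.returnTo l j i) = 2 * F.returnTurn j i := by
  rw [returnTo]
  refine ((phase_cast _ _ _ _).trans (F.phase_pairDisc _ _ _ _ _)).trans ?_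
  rw [returnTurn]
  congr 2
  funext t
  rw [coe_horizontal, coe_horizontal, height_not]
  apply Complex.ext
  · simp only [Complex.sub_re]
    ring
  · simp only [Complex.sub_im]
    ring

/-- The two end terms at strand `l` are at opposite heights and cancel; those at `κ_j` and `κ_i`
will cancel against the ones from `slide`. -/
theorem crossPhase_returnTo (V : Puncture) (l j i : Fin F.u) :
    F.crossPhase V (F.returnTo l j i) =
      2 * (F.ptArg V (F.kappa j) (height (decide (j < i))) +
        F.ptArg V (F.kappa i) (height !(decide (j < i)))) := by
  rw [returnTo]
  refine ((F.crossPhase_cast V _ _ _).trans (F.crossPhase_pathPair V _ _ _ _ _)).trans ?_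
  rw [phase_horizontal, phase_horizontal, height_not,
    ptArg_neg _ _ (F.kappa l)]
  ring

theorem returnTurn_self (i : Fin F.u) : F.returnTurn i i = 0 := by
  simp only [returnTurn, sub_self, mul_zero]
  refine turn_const _ fun e => height_ne_zero (decide (i < i)) ?_
  have := congrArg Complex.im e
  simpa using this

/-- For distinct indices, exchanging them negates the difference vector, which does not affect how
far it turns. -/
theorem returnTurn_comm (j i : Fin F.u) : F.returnTurn j i = F.returnTurn i j := by
  by_cases h : i = j
  · rw [h]
  · rw [returnTurn, returnTurn, ← turn_neg]
    · congr 1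
      funext t
      rw [F.decide_lt_eq_not h, height_not]
      apply Complex.ext
      · simp
        ring
      · simp
    · simp only [Complex.mk_eq_add_mul_I]
      fun_prop
    · intro t e
      have := congrArg Complex.im e
      exact height_ne_zero (decide (j < i)) (by simpa using this)

theorem phase_gammaTilde (j i : Fin F.u) :
    phase F.pairDisc (F.gammaTilde j i) =
      2 * (F.togetherTurn (2 * F.kappa i) - F.baseArg j i + F.returnTurn j i) := by
  rw [gammaTilde, phase_trans, phase_slide, phase_returnTo]
  ring

/-- The value at `κ_i` reached by the first slide cancels against the start of the joint slide. What
is left is symmetric in `j` and `i`. -/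
theorem phase_gammaTwo (j i : Fin F.u) :
    phase F.pairDisc (F.gammaTwo j i) =
      2 * (F.togetherTurn (2 * F.kappa F.kappaOmega) - F.baseArg j i + F.returnTurn j i) := by
  rw [gammaTwo, phase_trans, phase_trans, phase_slide, phase_slideBoth, phase_returnTo]
  ring

theorem crossPhase_gammaTwo (V : Puncture) (j i : Fin F.u) :
    F.crossPhase V (F.gammaTwo j i) =
      2 * (Real.pi * (2 * F.halfTurns V (F.kappa F.kappaOmega) - F.halfTurns V (F.kappa j) -
        F.halfTurns V (F.kappa i))) := by
  rw [gammaTwo, crossPhase_trans, crossPhase_trans, crossPhase_slide, crossPhase_slideBoth,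
    crossPhase_returnTo]
  ring

/-! ### The matrix `Q` -/

/-- The value of `(2Φ² - Ψ²_{X⁺})([γ²_{j,i}])` in terms of changes of arguments. -/
theorem pi_mul_gammaTwo (j i : Fin F.u) :
    Real.pi * ((2 * F.Phi (F.gammaTwo j i) - F.PsiTwo .Xplus (F.gammaTwo j i) : ℤ) : ℝ) =
      Real.pi * (2 * F.halfTurns .Xplus (F.kappa F.kappaOmega) - F.halfTurns .Xplus (F.kappa j) -
        F.halfTurns .Xplus (F.kappa i)) -
      (F.togetherTurn (2 * F.kappa F.kappaOmega) - F.baseArg j i + F.returnTurn j i) := by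
  have h1 := F.two_pi_mul_Phi (F.gammaTwo j i)
  have h2 := F.two_pi_mul_PsiTwo .Xplus (F.gammaTwo j i)
  have h3 := F.crossPhase_gammaTwo .Xplus j i
  rw [crossPhase] at h3
  have h4 := F.phase_gammaTwo j i
  push_cast
  -- Since `2Φ - Ψ² = Φ - (Ψ² - Φ)`, the pair phase enters with factor `-1/2` and the cross phase
  -- with factor `1/2`.
  linear_combination h1 - h2 / 2 + h3 / 2 - h4 / 2

/-- Hence the parity correction in `two_mul_togetherTurn` has the same value at all the points
`κ_i`. -/
theorem parity_kappa (i : Fin F.u) : F.parity (F.kappa i) = 0 := by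
  have h := F.kappa_mem i
  rw [parity, if_neg (by omega)]

/-- The coefficient `-3` is `1 - 4`: one `Ψ_{X⁺}` completes `Ψ_{X⁻,Y}` to the sum over all
punctures, which `two_mul_togetherTurn` converts into turning of the pair, and `-4Ψ_{X⁺}` gives the
remaining term. -/
theorem pi_mul_Qdiag (i : Fin F.u) :
    Real.pi * ((F.Qdiag i - F.mu3 : ℤ) : ℝ) =
      2 * (Real.pi *
        (F.halfTurns .Xplus (F.kappa F.kappaOmega) - F.halfTurns .Xplus (F.kappa i))) -
      (F.togetherTurn (2 * F.kappa F.kappaOmega) - F.togetherTurn (2 * F.kappa i)) := by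
  have h1 := F.two_mul_togetherTurn (F.kappa i)
  have h2 := F.two_mul_togetherTurn (F.kappa F.kappaOmega)
  rw [parity_kappa] at h1 h2
  have h3 := congrArg (Int.cast : ℤ → ℝ) (F.two_mul_Psi_singleton .Xplus i F.kappaOmega)
  have h4 := congrArg (Int.cast : ℤ → ℝ)
    (F.two_mul_Psi_pair (show Puncture.Xminus ≠ .Y by decide) i F.kappaOmega)
  rw [Qdiag]
  push_cast at h3 h4 ⊢
  linear_combination Real.pi / 2 * h4 - 3 * Real.pi / 2 * h3 + h2 / 2 - h1 / 2

theorem Q_eq (i j : Fin F.u) :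
    F.Q i j = 2 * F.Phi (F.gammaTwo j i) - F.PsiTwo .Xplus (F.gammaTwo j i) + F.mu3 := by
  have h1 := F.pi_mul_gammaTwo j i
  have h2 := F.pi_mul_Qdiag i
  rw [← sub_eq_iff_eq_add]
  have key : Real.pi * ((F.Q i j - F.mu3 : ℤ) : ℝ) =
      Real.pi * ((2 * F.Phi (F.gammaTwo j i) - F.PsiTwo .Xplus (F.gammaTwo j i) : ℤ) : ℝ) := by
    rw [h1, Q]
    split_ifs with h
    · subst h
      rw [h2, baseArg_self, returnTurn_self]
      ring
    · have h3 := F.two_pi_mul_Phi (F.gammaTilde j i)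
      rw [phase_gammaTilde] at h3
      have h4 := congrArg (Int.cast : ℤ → ℝ) (F.two_mul_Psi_singleton .Xplus j i)
      push_cast at h2 h4 ⊢
      -- The term `T(κ_i)` from the diagonal cancels with the one from `γ̃_{j,i}`, and
      -- `-2Ψ_{X⁺}(γ_{j,i})` turns `-2h(κ_i)` into `-h(κ_i) - h(κ_j)`.
      linear_combination h2 + h3 / 2 - Real.pi * h4
  exact_mod_cast mul_left_cancel₀ Real.pi_ne_zero key

theorem Q_symm (i j : Fin F.u) : F.Q i j = F.Q j i := by
  rw [Q_eq, Q_eq, add_left_inj]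
  have h := F.pi_mul_gammaTwo j i
  -- The other terms of `pi_mul_gammaTwo` are visibly symmetric in `j` and `i`.
  rw [F.baseArg_comm j i, F.returnTurn_comm j i] at h
  have key := h.trans ((show _ = _ by ring).trans (F.pi_mul_gammaTwo i j).symm)
  exact_mod_cast mul_left_cancel₀ Real.pi_ne_zero key

end KnotFraction

theorem mainTheorem3 (F : KnotFraction) :
    (∀ i j : Fin F.u,
      F.Q i j = 2 * F.Phi (F.gammaTwo j i) - F.PsiTwo .Xplus (F.gammaTwo j i) + F.mu3) ∧
    (∀ i j : Fin F.u, F.Q i j = F.Q j i) :=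
  ⟨F.Q_eq, F.Q_symm⟩
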